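/- Let $\Omega=(-1,1)$, $s\in(0,1)$ and $\gamma>0$. A mesh $\mathcal T$ on $\Omega$ is given by nodes $-1=x_0<x_1<\dots<x_M=1$ and consists of the open elements $T_i=(x_{i-1},x_i)$ with lengths $h_{T_i}=x_i-x_{i-1}$. It is $\gamma$-shape regular if $\gamma h_{T}\le h_{T'}$ for all $T,T'\in\mathcal T$ with $\overline{T}\cap\overline{T'}\neq\emptyset$. For $p\in\mathbb N$ let $$S_0^{p,1}(\mathcal T)=\{u\in H^1_0(\Omega): u|_T \text{ is a polynomial of degree at most } p \text{ for all } T\in\mathcal T\},$$ and let, with $r(x)=\operatorname{dist}(x,\partial\Omega)$, $$\|u\|^2_{\widetilde H^s(\Omega)}=\int_\Omega |u|^2\,dx+\int_\Omega\int_\Omega\frac{|u(x)-u(y)|^2}{|x-y|^{1+2s}}\,dy\,dx+\int_\Omega \Big|\frac{u(x)}{r(x)^{s}}\Big|^2dx .$$ For $\alpha,\beta>-1$ let $GJ_n^{\alpha,\beta}$ denote the $n$-point Gauss quadrature rule on $(0,1)$ for the weight $(1-x)^\alpha x^\beta$: its nodes are the zeros of the $n$-th orthogonal polynomial for this weight,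 and its quadrature weights are the weighted integrals of the associated Lagrange polynomials. Let $GL_n=GJ_n^{0,0}$; a second index $x$ or $y$ indicates the variable to which a rule is applied. For $T=(x_\ell,x_r)\in\mathcal T$ write $\hat v_T(x)=v(x_\ell+xh_T)$. For $v,w\in S_0^{p,1}(\mathcal T)$ define $Q^n_{T,T'}(v,w)$ as follows. (a) Identical elements: $$Q^n_{T,T}(v,w)=2h_T^{1-2s}\,GJ_{n,x}^{0,2-2s}\circ GJ_{n,y}^{1-2s,0}\left(\frac{(\hat v_T(x)-\hat v_T(xy))(\hat w_T(x)-\hat w_T(xy))}{|x-xy|^2}\right).$$ (b) If $T$ is the left neighbour of $T'$: $$\begin{aligned}Q^n_{T,T'}(v,w)=h_Th_{T'}\Big(&GJ_{n,x}^{0,2-2s}\circ GL_{n,y}\Big(\tfrac{(\hat v_T(1-x)-\hat v_{T'}(xy))(\hat w_T(1-x)-\hat w_{T'}(xy))}{|h_T+yh_{T'}|^{1+2s}x^2}\Big)\\&+GL_{n,x}\circ GJ_{n,y}^{0,2-2s}\Big(\tfrac{(\hat v_T(1-xy)-\hat v_{T'}(y))(\hat w_T(1-xy)-\hat w_{T'}(y))}{|xh_T+h_{T'}|^{1+2s}y^2}\Big)\Big).\end{aligned}$$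 (c) If $\overline T\cap\overline{T'}=\emptyset$ and $T$ lies to the left of $T'$: $$Q^n_{T,T'}(v,w)=h_Th_{T'}\,GL_{n,x}\circ GL_{n,y}\left(\frac{(\hat v_T(x)-\hat v_{T'}(y))(\hat w_T(x)-\hat w_{T'}(y))}{|(1-x)h_T+\operatorname{dist}(T,T')+yh_{T'}|^{1+2s}}\right).$$ If $T$ lies to the right of $T'$, set $Q^n_{T,T'}(v,w)=Q^n_{T',T}(v,w)$. (d) For $\Omega^c=\mathbb R\setminus\Omega$ set $Q^n_{T,\Omega^c}(v,w)=\frac{h_T}{2s}(L_T+R_T)$. Here $$L_T=GL_n\Big(\frac{\hat v_T(x)\hat w_T(x)}{|\operatorname{dist}(T,-1)+xh_T|^{2s}}\Big)\ \text{ if } -1\notin\overline T,\qquad L_T=GJ_n^{0,2-2s}\Big(\frac{\hat v_T(x)\hat w_T(x)}{x^2h_T^{2s}}\Big)\ \text{ if } -1\in\overline T,$$ $$R_T=GL_n\Big(\frac{\hat v_T(x)\hat w_T(x)}{|\operatorname{dist}(T,1)+(1-x)h_T|^{2s}}\Big)\ \text{ if } 1\notin\overline T,\qquad R_T=GJ_n^{2-2s,0}\Big(\frac{\hat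 v_T(x)\hat w_T(x)}{(1-x)^2h_T^{2s}}\Big)\ \text{ if } 1\in\overline T.$$ Finally, with $C(s)=-2^{2s}\frac{\Gamma(s+1/2)}{\pi^{1/2}\Gamma(-s)}$, let $$\widetilde a_n(v,w)=\frac{C(s)}{2}\Big(\sum_{T\in\mathcal T}\sum_{T'\in\mathcal T}Q^n_{T,T'}(v,w)+2\sum_{T\in\mathcal T}Q^n_{T,\Omega^c}(v,w)\Big).$$ Then there is a constant $c_{\mathrm{coer}}>0$ depending only on $\gamma$ and $s$ such that, for every $\gamma$-shape regular mesh $\mathcal T$ on $\Omega$, all $p,n\in\mathbb N$ with $n\ge p+1$ and all $u\in S_0^{p,1}(\mathcal T)$, the norm $\|u\|_{\widetilde H^s(\Omega)}$ is finite and $$\widetilde a_n(u,u)\ \ge\ c_{\mathrm{coer}}\,\|u\|^2_{\widetilde H^s(\Omega)}.$$ -/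

import Mathlib

namespace FracQuad

open MeasureTheory Polynomial Filter Topology
open scoped ENNReal ContDiff

noncomputable section

/-! Gaussian quadrature on `(0,1)` for a weight function `wt`. -/

/-- The `wt`-weighted `L²(0,1)` inner product of two polynomials. -/
def weightedInner (wt : ℝ → ℝ) (P Q : ℝ[X]) : ℝ :=
  ∫ x in (0 : ℝ)..1, P.eval x * Q.eval x * wt x

/-- The monic orthogonal polynomial of degree `n` for `wt` (Gram-Schmidt applied to the monomials). -/
def orthoPoly (wt : ℝ → ℝ) : ℕ → ℝ[X]
  | n => X ^ n - ∑ k : Fin n,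
      C (weightedInner wt (X ^ n) (orthoPoly wt k)
          / weightedInner wt (orthoPoly wt k) (orthoPoly wt k)) * orthoPoly wt k

/-- The Gaussian nodes: the zeros of the `n`-th orthogonal polynomial. -/
def gaussNodes (wt : ℝ → ℝ) (n : ℕ) : Finset ℝ := (orthoPoly wt n).roots.toFinset

/-- The weight of the node `ξ`: the weighted integral of the Lagrange polynomial of `ξ`. -/
def gaussWeight (wt : ℝ → ℝ) (n : ℕ) (ξ : ℝ) : ℝ :=
  ∫ x in (0 : ℝ)..1, wt x * (Lagrange.basis (gaussNodes wt n) id ξ).eval x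

/-- The `n`-point Gaussian quadrature rule for the weight `wt`. -/
def gaussQuad (wt : ℝ → ℝ) (n : ℕ) (Φ : ℝ → ℝ) : ℝ :=
  ∑ ξ ∈ gaussNodes wt n, gaussWeight wt n ξ * Φ ξ

/-- Gauss-Legendre quadrature on `(0,1)`. -/
def gaussLegendre (n : ℕ) (Φ : ℝ → ℝ) : ℝ := gaussQuad (fun _ => 1) n Φ

/-- Gauss-Jacobi quadrature on `(0,1)` with weight `(1-x)^α x^β`. -/
def gaussJacobi (α β : ℝ) (n : ℕ) (Φ : ℝ → ℝ) : ℝ :=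
  gaussQuad (fun x => (1 - x) ^ α * x ^ β) n Φ

/-! Meshes. -/

/-- The domain `(-1,1)`. -/
def Ω : Set ℝ := Set.Ioo (-1) 1

/-- A mesh on `(-1,1)`, given by its nodes `-1 = x₀ < ⋯ < x_M = 1`. -/
structure Mesh where
  M : ℕ
  node : Fin (M + 1) → ℝ
  strictMono_node : StrictMono node
  node_zero : node 0 = -1
  node_last : node (Fin.last M) = 1

namespace Mesh

variable (𝒯 : Mesh)

/-- Left end point of the element with index `i`. -/
def left (i : Fin 𝒯.M) : ℝ := 𝒯.node i.castSucc

/-- Right end point of the element with index `i`. -/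
def right (i : Fin 𝒯.M) : ℝ := 𝒯.node i.succ

/-- The (open) element with index `i`. -/
def elem (i : Fin 𝒯.M) : Set ℝ := Set.Ioo (𝒯.left i) (𝒯.right i)

/-- The length of the element with index `i`. -/
def h (i : Fin 𝒯.M) : ℝ := 𝒯.right i - 𝒯.left i

/-- `γ`-shape regularity. -/
def ShapeRegular (γ : ℝ) : Prop :=
  ∀ i j : Fin 𝒯.M, (closure (𝒯.elem i) ∩ closure (𝒯.elem j)).Nonempty → γ * 𝒯.h i ≤ 𝒯.h j

/-- The pullback `v ∘ F_T` of `v` to the reference element `(0,1)`. -/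
def pull (v : ℝ → ℝ) (i : Fin 𝒯.M) (x : ℝ) : ℝ := v (𝒯.left i + x * 𝒯.h i)

end Mesh

/-! Sobolev spaces on `Ω` and spline spaces. Functions are representatives `ℝ → ℝ`, of which only
the values on `Ω` matter. -/

/-- Smooth test functions with compact support in `Ω`. -/
def IsTest (φ : ℝ → ℝ) : Prop :=
  ContDiff ℝ ∞ φ ∧ HasCompactSupport φ ∧ tsupport φ ⊆ Ω

/-- `g` is a weak derivative of `u` on `Ω`. -/
def IsWeakDeriv (u g : ℝ → ℝ) : Prop :=
  ∀ φ : ℝ → ℝ, IsTest φ → ∫ x in Ω, u x * deriv φ x = - ∫ x in Ω, g x * φ x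

/-- The Sobolev space `H¹(Ω)`. -/
def H1 : Set (ℝ → ℝ) :=
  {u | MemLp u 2 (volume.restrict Ω) ∧
    ∃ g : ℝ → ℝ, MemLp g 2 (volume.restrict Ω) ∧ IsWeakDeriv u g}

/-- The space `H¹₀(Ω)`: the closure of the test functions in `H¹(Ω)`. -/
def H10 : Set (ℝ → ℝ) :=
  {u | MemLp u 2 (volume.restrict Ω) ∧
    ∃ g : ℝ → ℝ, MemLp g 2 (volume.restrict Ω) ∧ IsWeakDeriv u g ∧
      ∃ φ : ℕ → ℝ → ℝ, (∀ k, IsTest (φ k)) ∧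
        Tendsto (fun k => eLpNorm (fun x => u x - φ k x) 2 (volume.restrict Ω)) atTop (𝓝 0) ∧
        Tendsto (fun k => eLpNorm (fun x => g x - deriv (φ k) x) 2 (volume.restrict Ω))
          atTop (𝓝 0)}

/-- The spline space `S^{p,1}(𝒯)`. -/
def spline (𝒯 : Mesh) (p : ℕ) : Set (ℝ → ℝ) :=
  {u | u ∈ H1 ∧ ∀ i : Fin 𝒯.M, ∃ P : ℝ[X], P.natDegree ≤ p ∧ ∀ x ∈ 𝒯.elem i, u x = P.eval x}

/-- The spline space `S₀^{p,1}(𝒯)`. -/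
def spline0 (𝒯 : Mesh) (p : ℕ) : Set (ℝ → ℝ) := spline 𝒯 p ∩ H10

/-- The distance of `x ∈ Ω` to the boundary `{-1, 1}`. -/
def bdist (x : ℝ) : ℝ := Metric.infDist x (frontier Ω)

/-- The squared norm `‖v‖²_{L²(Ω)} + |v|²_{H^s(Ω)} + ‖v / r^s‖²_{L²(Ω)}`, `r` the distance to the
boundary, with values in `[0,∞]`. -/
def HtildeNormSq (s : ℝ) (v : ℝ → ℝ) : ℝ≥0∞ :=
  (∫⁻ x in Ω, ENNReal.ofReal (|v x| ^ 2))
    + (∫⁻ x in Ω, ∫⁻ y in Ω, ENNReal.ofReal (|v x - v y| ^ 2 / |x - y| ^ (1 + 2 * s)))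
    + ∫⁻ x in Ω, ENNReal.ofReal (|v x / bdist x ^ s| ^ 2)

/-! The quadrature approximations of the double integrals. -/

/-- The normalisation constant of the fractional Laplacian in dimension one. -/
def fracConst (s : ℝ) : ℝ :=
  -((2 : ℝ) ^ (2 * s) * Real.Gamma (s + 1 / 2) / (Real.pi ^ (1 / 2 : ℝ) * Real.Gamma (-s)))

variable (𝒯 : Mesh) (s : ℝ) (n : ℕ) (v w : ℝ → ℝ)

/-- Identical elements. -/
def Qident (i : Fin 𝒯.M) : ℝ :=
  2 * 𝒯.h i ^ (1 - 2 * s) *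
    gaussJacobi 0 (2 - 2 * s) n fun x => gaussJacobi (1 - 2 * s) 0 n fun y =>
      (𝒯.pull v i x - 𝒯.pull v i (x * y)) * (𝒯.pull w i x - 𝒯.pull w i (x * y))
        / |x - x * y| ^ 2

/-- Adjacent elements, where `i` is the left neighbour of `j`. -/
def Qadj (i j : Fin 𝒯.M) : ℝ :=
  𝒯.h i * 𝒯.h j *
    ((gaussJacobi 0 (2 - 2 * s) n fun x => gaussLegendre n fun y =>
        (𝒯.pull v i (1 - x) - 𝒯.pull v j (x * y)) * (𝒯.pull w i (1 - x) - 𝒯.pull w j (x * y))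
          / (|𝒯.h i + y * 𝒯.h j| ^ (1 + 2 * s) * x ^ 2))
    + (gaussLegendre n fun x => gaussJacobi 0 (2 - 2 * s) n fun y =>
        (𝒯.pull v i (1 - x * y) - 𝒯.pull v j y) * (𝒯.pull w i (1 - x * y) - 𝒯.pull w j y)
          / (|x * 𝒯.h i + 𝒯.h j| ^ (1 + 2 * s) * y ^ 2)))

/-- Separated elements, where `i` lies to the left of `j`; the distance of the two elements is
`left j - right i`. -/
def Qsep (i j : Fin 𝒯.M) : ℝ :=
  𝒯.h i * 𝒯.h j *
    gaussLegendre n fun x => gaussLegendre n fun y =>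
      (𝒯.pull v i x - 𝒯.pull v j y) * (𝒯.pull w i x - 𝒯.pull w j y)
        / |(1 - x) * 𝒯.h i + (𝒯.left j - 𝒯.right i) + y * 𝒯.h j| ^ (1 + 2 * s)

/-- The quadrature for a pair of elements; the roles are exchanged if `i` lies to the right
of `j`. -/
def Qelem (i j : Fin 𝒯.M) : ℝ :=
  if i = j then Qident 𝒯 s n v w i
  else if (i : ℕ) + 1 = j then Qadj 𝒯 s n v w i j
  else if (j : ℕ) + 1 = i then Qadj 𝒯 s n v w j i
  else if i < j then Qsep 𝒯 s n v w i j
  else Qsep 𝒯 s n v w j i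

/-- The quadrature for an element and the complement of `Ω`: Gauss-Jacobi for the singular term at
an end point of `Ω` that belongs to the closure of the element, Gauss-Legendre otherwise. -/
def Qcompl (i : Fin 𝒯.M) : ℝ :=
  𝒯.h i / (2 * s) *
    ((if (i : ℕ) = 0 then
        gaussJacobi 0 (2 - 2 * s) n fun x => 𝒯.pull v i x * 𝒯.pull w i x / (x ^ 2 * 𝒯.h i ^ (2 * s))
      else
        gaussLegendre n fun x => 𝒯.pull v i x * 𝒯.pull w i x
          / |(𝒯.left i - (-1)) + x * 𝒯.h i| ^ (2 * s))
    + (if (i : ℕ) + 1 = 𝒯.M then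
        gaussJacobi (2 - 2 * s) 0 n fun x =>
          𝒯.pull v i x * 𝒯.pull w i x / ((1 - x) ^ 2 * 𝒯.h i ^ (2 * s))
      else
        gaussLegendre n fun x => 𝒯.pull v i x * 𝒯.pull w i x
          / |(1 - 𝒯.right i) + (1 - x) * 𝒯.h i| ^ (2 * s)))

/-- The approximate bilinear form `ã_n(v,w)`. -/
def aTilde : ℝ :=
  fracConst s / 2 *
    ((∑ i : Fin 𝒯.M, ∑ j : Fin 𝒯.M, Qelem 𝒯 s n v w i j) + 2 * ∑ i : Fin 𝒯.M, Qcompl 𝒯 s n v w i)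

end

end FracQuad

/-! The point is that the quadrature form dominates the norm even though the kernels are not
polynomial, so the quadrature need not be exact. Mapped to the reference square or interval, and
after a Duffy transformation for touching elements, each integrand on the diagonal takes the form `S
^ 2 / D ^ a` times a Jacobi weight. Here `S` is a polynomial of degree at most `p` in each variable
and `D` satisfies `lo ≤ D ≤ K * lo`. Freezing `D` at `lo` enlarges the integral. The remaining
integral of `S ^ 2` is computed exactly by the rule, because its degree is at most `2p ≤ 2n - 1` in
each variable. Since the Gauss weights are nonnegative and the nodes lie in `(0,1)`, restoring `D`
under the quadrature costs only the factor `K ^ a`. This is `lintegral_le_gaussQuad` and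
`lintegral_lintegral_le_gaussQuad`.

The singular factors `x ^ 2` and `|x - x * y| ^ 2` divide the numerators: differences of one
polynomial vanish on the diagonal, neighbouring pieces match at the common node, and boundary pieces
vanish at `±1`. The last two facts come from the continuous representative of an `H¹₀` function
(`exists_continuousOn_of_mem_H10`, `exists_pieces`).

Shape regularity bounds an element by its distance to whatever it does not touch, and by its
neighbour's length, so `K = 1 + 2 / γ` serves every case. Summation over elements controls the
double integral by the `Qelem` sum and the boundary weighted integral by the `Qcompl` sum. The `L²`
part is below the weighted part because the distance to the boundary is at most one. -/

namespace FracQuad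

open MeasureTheory Polynomial Filter Topology
open scoped ENNReal ContDiff

/-! ### Orthogonal polynomials for a positive weight: orthogonality and location of zeros. -/

/-- A weight on `(0,1)`: positive and integrable. -/
structure IsQuadWeight (wt : ℝ → ℝ) : Prop where
  pos : ∀ x ∈ Set.Ioo (0 : ℝ) 1, 0 < wt x
  integrable : IntervalIntegrable wt volume 0 1

namespace IsQuadWeight

variable {wt : ℝ → ℝ}

theorem integrable_eval_mul (h : IsQuadWeight wt) (P : ℝ[X]) :
    IntervalIntegrable (fun x => P.eval x * wt x) volume 0 1 :=
  h.integrable.continuousOn_mul P.continuous.continuousOn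

/-- Integration of polynomials against a weight, as a linear functional. -/
noncomputable def functional (h : IsQuadWeight wt) : ℝ[X] →ₗ[ℝ] ℝ where
  toFun P := ∫ x in (0 : ℝ)..1, P.eval x * wt x
  map_add' P Q := by
    rw [← intervalIntegral.integral_add (h.integrable_eval_mul P) (h.integrable_eval_mul Q)]
    simp [add_mul]
  map_smul' c P := by
    simp [mul_assoc]

theorem functional_apply (h : IsQuadWeight wt) (P : ℝ[X]) :
    h.functional P = ∫ x in (0 : ℝ)..1, P.eval x * wt x := rfl

theorem weightedInner_eq (h : IsQuadWeight wt) (P Q : ℝ[X]) :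
    weightedInner wt P Q = h.functional (P * Q) := by
  simp [weightedInner, functional_apply]

theorem functional_nonneg (h : IsQuadWeight wt) {P : ℝ[X]}
    (hP : ∀ x ∈ Set.Ioo (0 : ℝ) 1, 0 ≤ P.eval x) : 0 ≤ h.functional P := by
  rw [functional_apply, intervalIntegral.integral_of_le zero_le_one,
    integral_Ioc_eq_integral_Ioo]
  exact setIntegral_nonneg measurableSet_Ioo fun x hx => mul_nonneg (hP x hx) (h.pos x hx).le

/-- A zero integral would force `P` to vanish almost everywhere on `(0,1)`, hence everywhere there
by continuity, and so to have infinitely many roots. -/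
theorem functional_pos (h : IsQuadWeight wt) {P : ℝ[X]} (hP0 : P ≠ 0)
    (hP : ∀ x ∈ Set.Ioo (0 : ℝ) 1, 0 ≤ P.eval x) : 0 < h.functional P := by
  refine lt_of_le_of_ne (h.functional_nonneg hP) fun h0 => hP0 ?_
  rw [functional_apply, intervalIntegral.integral_of_le zero_le_one,
    integral_Ioc_eq_integral_Ioo, eq_comm, setIntegral_eq_zero_iff_of_nonneg_ae] at h0
  · have hae : ∀ᵐ x ∂volume.restrict (Set.Ioo (0 : ℝ) 1), P.eval x = 0 := by
      filter_upwards [h0, ae_restrict_mem measurableSet_Ioo] with x hx hx'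
      have := mul_eq_zero.1 hx
      exact this.resolve_right (h.pos x hx').ne'
    have hE : Set.EqOn (fun x => P.eval x) (fun _ => 0) (Set.Ioo (0 : ℝ) 1) :=
      Measure.eqOn_open_of_ae_eq hae isOpen_Ioo P.continuous.continuousOn continuousOn_const
    exact P.eq_zero_of_infinite_isRoot ((Set.Ioo_infinite zero_lt_one).mono hE)
  · filter_upwards [ae_restrict_mem measurableSet_Ioo] with x hx
    exact mul_nonneg (hP x hx) (h.pos x hx).le
  · exact ((intervalIntegrable_iff_integrableOn_Ioo_of_le zero_le_one).1
      (h.integrable_eval_mul P))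

theorem functional_sq_pos (h : IsQuadWeight wt) {P : ℝ[X]} (hP0 : P ≠ 0) :
    0 < h.functional (P * P) :=
  h.functional_pos (mul_ne_zero hP0 hP0) fun x _ => by
    rw [eval_mul]; exact mul_self_nonneg _

end IsQuadWeight

theorem orthoPoly_monic_degree (wt : ℝ → ℝ) (n : ℕ) :
    (orthoPoly wt n).Monic ∧ (orthoPoly wt n).degree = n := by
  induction n using Nat.strong_induction_on with
  | _ n ih =>
    have hlt : (∑ k : Fin n,
      C (weightedInner wt (X ^ n) (orthoPoly wt k)
          / weightedInner wt (orthoPoly wt k) (orthoPoly wt k)) * orthoPoly wt k).degree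
        < (X ^ n : ℝ[X]).degree := by
      rw [degree_X_pow]
      refine lt_of_le_of_lt (degree_sum_le _ _) ?_
      refine (Finset.sup_lt_iff (WithBot.bot_lt_coe n)).2 fun k _ => ?_
      rw [← smul_eq_C_mul]
      refine lt_of_le_of_lt (degree_smul_le _ _) ?_
      rw [(ih k k.2).2]
      exact Nat.cast_lt.2 k.2
    rw [orthoPoly]
    refine ⟨(monic_X_pow n).sub_of_left hlt, ?_⟩
    rw [degree_sub_eq_left_of_degree_lt hlt, degree_X_pow]

theorem orthoPoly_monic (wt : ℝ → ℝ) (n : ℕ) : (orthoPoly wt n).Monic :=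
  (orthoPoly_monic_degree wt n).1

theorem orthoPoly_degree (wt : ℝ → ℝ) (n : ℕ) : (orthoPoly wt n).degree = n :=
  (orthoPoly_monic_degree wt n).2

theorem orthoPoly_natDegree (wt : ℝ → ℝ) (n : ℕ) : (orthoPoly wt n).natDegree = n :=
  natDegree_eq_of_degree_eq_some (orthoPoly_degree wt n)

namespace IsQuadWeight

variable {wt : ℝ → ℝ}

theorem orthoPoly_orthogonal (h : IsQuadWeight wt) (n : ℕ) :
    ∀ j < n, h.functional (orthoPoly wt n * orthoPoly wt j) = 0 := by
  induction n using Nat.strong_induction_on with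
  | _ n ih =>
    intro j hj
    rw [orthoPoly, sub_mul, map_sub, Finset.sum_mul, map_sum,
      Finset.sum_eq_single (⟨j, hj⟩ : Fin n)]
    · have hne := (h.functional_sq_pos (orthoPoly_monic wt j).ne_zero).ne'
      rw [mul_assoc, ← smul_eq_C_mul, map_smul, h.weightedInner_eq, h.weightedInner_eq,
        smul_eq_mul, div_mul_cancel₀ _ hne, sub_self]
    · intro k _ hk
      rw [mul_assoc, ← smul_eq_C_mul, map_smul, smul_eq_mul]
      have hkj : (k : ℕ) ≠ j := fun e => hk (Fin.ext e)
      rcases lt_or_gt_of_ne hkj with hlt | hlt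
      · rw [mul_comm (orthoPoly wt k), ih j hj k hlt, mul_zero]
      · rw [ih k k.2 j hlt, mul_zero]
    · simp

/-- The monic polynomials `orthoPoly wt j` with `j < n` span all lower degrees: subtracting the
right multiple of one of them removes the leading term of `q`, which drives an induction on the
degree bound. -/
theorem functional_orthoPoly_mul (h : IsQuadWeight wt) {n : ℕ} {q : ℝ[X]} (hq : q.degree < n) :
    h.functional (orthoPoly wt n * q) = 0 := by
  have key : ∀ m ≤ n, ∀ q : ℝ[X], q.degree < m → h.functional (orthoPoly wt n * q) = 0 := by
    intro m
    induction m with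
    | zero =>
      intro _ q hq
      have : q = 0 := by simpa [Nat.WithBot.lt_zero_iff] using hq
      simp [this]
    | succ m ih =>
      intro hm q hq
      have hr : (q - C (q.coeff m) * orthoPoly wt m).degree < m := by
        rw [degree_lt_iff_coeff_zero]
        intro k hk
        rcases hk.eq_or_lt with rfl | hk
        · have : (orthoPoly wt m).coeff m = 1 := by
            have := orthoPoly_monic wt m
            rwa [Monic, leadingCoeff, orthoPoly_natDegree] at this
          simp [this]
        · have h1 : q.coeff k = 0 := (degree_lt_iff_coeff_zero _ _).1 hq k hk
          have h2 : (orthoPoly wt m).coeff k = 0 :=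
            coeff_eq_zero_of_natDegree_lt (by rwa [orthoPoly_natDegree])
          simp [h1, h2]
      have e : q = (q - C (q.coeff m) * orthoPoly wt m) + q.coeff m • orthoPoly wt m := by
        rw [smul_eq_C_mul]; ring
      rw [e, mul_add, map_add, ih (by omega) _ hr, mul_smul_comm, map_smul,
        h.orthoPoly_orthogonal n m (by omega), smul_zero, add_zero]
  exact key n le_rfl q hq

/-- A nontrivial factor of an orthogonal polynomial has no constant sign on `(0,1)`. -/
theorem not_nonneg_of_orthoPoly_eq_mul (h : IsQuadWeight wt) {n : ℕ} {f q : ℝ[X]}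
    (e : orthoPoly wt n = f * q) (hf : 0 < f.degree) :
    ¬ ∀ x ∈ Set.Ioo (0 : ℝ) 1, 0 ≤ f.eval x := by
  intro hsgn
  have hne := (orthoPoly_monic wt n).ne_zero
  have hf0 : f ≠ 0 := fun h0 => hne (by rw [e, h0, zero_mul])
  have hq0 : q ≠ 0 := fun h0 => hne (by rw [e, h0, mul_zero])
  have hdeg : q.degree < n := by
    have h1 := orthoPoly_natDegree wt n
    rw [e, natDegree_mul hf0 hq0] at h1
    have h2 := natDegree_pos_iff_degree_pos.2 hf
    rw [degree_eq_natDegree hq0]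
    exact_mod_cast (by omega : q.natDegree < n)
  have h0 := h.functional_orthoPoly_mul hdeg
  rw [e] at h0
  -- If `f` were nonnegative, `f * q ^ 2` would have positive integral; but it equals the orthogonal
  -- polynomial times `q`, which has degree below `n`.
  refine (h.functional_pos (P := f * q * q) (mul_ne_zero (mul_ne_zero hf0 hq0) hq0) ?_).ne' h0
  intro x hx
  rw [eval_mul, eval_mul, mul_assoc]
  exact mul_nonneg (hsgn x hx) (mul_self_nonneg _)

/-- Neither `f` nor `-f` is nonnegative on `(0,1)`, so the intermediate value theorem gives a zero.
-/
theorem exists_root_of_dvd_orthoPoly (h : IsQuadWeight wt) {n : ℕ} {f : ℝ[X]}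
    (hd : f ∣ orthoPoly wt n) (hf : 0 < f.degree) :
    ∃ x ∈ Set.Ioo (0 : ℝ) 1, f.eval x = 0 := by
  by_contra! hno
  obtain ⟨q, e⟩ := hd
  have h1 := h.not_nonneg_of_orthoPoly_eq_mul e hf
  have h2 := h.not_nonneg_of_orthoPoly_eq_mul (f := -f) (q := -q) (by rw [e]; ring)
    (by rwa [degree_neg])
  push Not at h1 h2
  obtain ⟨x, hx, hx'⟩ := h1
  obtain ⟨y, hy, hy'⟩ := h2
  rw [eval_neg, neg_lt_zero] at hy'
  obtain ⟨z, hz, hz'⟩ := isPreconnected_Ioo.intermediate_value hx hy f.continuous.continuousOn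
    ⟨hx'.le, hy'.le⟩
  exact hno z hz hz'

/-- Every irreducible factor has a real root, hence is linear. -/
theorem orthoPoly_splits (h : IsQuadWeight wt) (n : ℕ) : (orthoPoly wt n).Splits := by
  obtain ⟨u, hu⟩ := UniqueFactorizationMonoid.factors_prod (orthoPoly_monic wt n).ne_zero
  rw [← hu]
  refine (Splits.multisetProd fun g hg => Splits.of_degree_eq_one ?_).mul u.isUnit.splits
  have hirr := UniqueFactorizationMonoid.irreducible_of_factor g hg
  obtain ⟨x, -, hx⟩ := h.exists_root_of_dvd_orthoPoly
    (UniqueFactorizationMonoid.dvd_of_mem_factors hg) (degree_pos_of_irreducible hirr)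
  exact degree_eq_one_of_irreducible_of_root hirr hx

theorem mem_Ioo_of_mem_gaussNodes (h : IsQuadWeight wt) {n : ℕ} {ξ : ℝ}
    (hξ : ξ ∈ gaussNodes wt n) : ξ ∈ Set.Ioo (0 : ℝ) 1 := by
  rw [gaussNodes, Multiset.mem_toFinset, mem_roots (orthoPoly_monic wt n).ne_zero] at hξ
  obtain ⟨x, hx, hx'⟩ := h.exists_root_of_dvd_orthoPoly (dvd_iff_isRoot.2 hξ)
    (by rw [degree_X_sub_C]; exact zero_lt_one)
  have : x = ξ := by simpa [sub_eq_zero] using hx'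
  rwa [← this]

/-- A multiple root `ξ` would give the factor `(X - ξ) ^ 2`, which has constant sign. -/
theorem orthoPoly_roots_nodup (h : IsQuadWeight wt) (n : ℕ) : (orthoPoly wt n).roots.Nodup := by
  rw [Multiset.nodup_iff_count_le_one]
  intro ξ
  rw [count_roots]
  by_contra! hc
  have hd : (X - C ξ) ^ 2 ∣ orthoPoly wt n :=
    (pow_dvd_pow _ hc).trans (pow_rootMultiplicity_dvd _ _)
  obtain ⟨q, e⟩ := hd
  refine h.not_nonneg_of_orthoPoly_eq_mul e ?_ fun x _ => ?_
  · rw [degree_pow, degree_X_sub_C]; norm_num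
  · rw [eval_pow]; exact sq_nonneg _

/-! ### Exactness and positivity of Gaussian quadrature. -/

theorem card_gaussNodes (h : IsQuadWeight wt) (n : ℕ) : (gaussNodes wt n).card = n := by
  rw [gaussNodes, Multiset.toFinset_card_of_nodup (h.orthoPoly_roots_nodup n),
    ← (h.orthoPoly_splits n).natDegree_eq_card_roots, orthoPoly_natDegree]

theorem gaussWeight_eq (h : IsQuadWeight wt) (n : ℕ) (ξ : ℝ) :
    gaussWeight wt n ξ = h.functional (Lagrange.basis (gaussNodes wt n) id ξ) := by
  simp [gaussWeight, functional_apply, mul_comm]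

theorem gaussQuad_eq_of_degree_lt (h : IsQuadWeight wt) {n : ℕ} {P : ℝ[X]} (hP : P.degree < n) :
    gaussQuad wt n (fun x => P.eval x) = h.functional P := by
  have e := Lagrange.eq_interpolate (s := gaussNodes wt n) (v := id) (f := P)
    Function.injective_id.injOn (by rwa [h.card_gaussNodes])
  conv_rhs => rw [e]
  rw [Lagrange.interpolate_apply, map_sum, gaussQuad]
  refine Finset.sum_congr rfl fun ξ _ => ?_
  rw [← smul_eq_C_mul, map_smul, h.gaussWeight_eq, smul_eq_mul, mul_comm, id]

/-- Gaussian quadrature with `n` points is exact up to degree `2n - 1`. -/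
theorem gaussQuad_exact (h : IsQuadWeight wt) {n : ℕ} {P : ℝ[X]} (hP : P.degree < (2 * n : ℕ)) :
    gaussQuad wt n (fun x => P.eval x) = h.functional P := by
  -- Divide `P` by the orthogonal polynomial. The multiple of the divisor vanishes at the nodes and,
  -- its quotient having degree below `n`, also integrates to zero; the remainder is reproduced by
  -- Lagrange interpolation.
  have hm := orthoPoly_monic wt n
  have hr : (P %ₘ orthoPoly wt n).degree < n := by
    rw [← orthoPoly_degree wt n]; exact degree_modByMonic_lt _ hm
  have hq : (P /ₘ orthoPoly wt n).degree < n := by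
    by_cases h0 : P /ₘ orthoPoly wt n = 0
    · rw [h0, degree_zero]; exact WithBot.bot_lt_coe n
    have hn := natDegree_divByMonic P hm
    rw [orthoPoly_natDegree] at hn
    have hP0 : P ≠ 0 := fun e => h0 (by rw [e, zero_divByMonic])
    rw [degree_eq_natDegree hP0] at hP
    have : P.natDegree < 2 * n := by exact_mod_cast hP
    rw [degree_eq_natDegree h0]
    have : 0 < n := by omega
    exact_mod_cast (by omega : (P /ₘ orthoPoly wt n).natDegree < n)
  have e := modByMonic_add_div P (orthoPoly wt n)
  have e2 : gaussQuad wt n (fun x => P.eval x)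
      = gaussQuad wt n (fun x => (P %ₘ orthoPoly wt n).eval x) := by
    refine Finset.sum_congr rfl fun ξ hξ => ?_
    rw [gaussNodes, Multiset.mem_toFinset, mem_roots hm.ne_zero] at hξ
    dsimp only
    conv_lhs => rw [← e]
    rw [eval_add, eval_mul, hξ.eq_zero, zero_mul, add_zero]
  rw [e2, h.gaussQuad_eq_of_degree_lt hr]
  conv_rhs => rw [← e]
  rw [map_add, h.functional_orthoPoly_mul hq, add_zero]

/-- The square of the Lagrange polynomial of `ξ` has degree at most `2n - 2`, so its nonnegative
integral is computed exactly, and the rule returns just the weight of `ξ`. -/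
theorem gaussWeight_nonneg (h : IsQuadWeight wt) {n : ℕ} {ξ : ℝ} (hξ : ξ ∈ gaussNodes wt n) :
    0 ≤ gaussWeight wt n ξ := by
  set B := Lagrange.basis (gaussNodes wt n) id ξ
  have hn : 0 < n := by
    rw [← h.card_gaussNodes n]; exact Finset.card_pos.2 ⟨ξ, hξ⟩
  have hB : B.natDegree ≤ n - 1 := by
    refine natDegree_le_of_degree_le ?_
    rw [Lagrange.degree_basis Function.injective_id.injOn hξ, h.card_gaussNodes]
  have hdeg : (B * B).degree < (2 * n : ℕ) := by
    refine lt_of_le_of_lt degree_le_natDegree ?_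
    have := natDegree_mul_le (p := B) (q := B)
    exact_mod_cast (by omega : (B * B).natDegree < 2 * n)
  have e := h.gaussQuad_exact hdeg
  have e2 : gaussQuad wt n (fun x => (B * B).eval x) = gaussWeight wt n ξ := by
    rw [gaussQuad, Finset.sum_eq_single_of_mem ξ hξ]
    · have : B.eval ξ = 1 :=
        Lagrange.eval_basis_self (v := id) Function.injective_id.injOn hξ
      simp [this]
    · intro ζ hζ hne
      have : B.eval ζ = 0 := Lagrange.eval_basis_of_ne (v := id) hne.symm hζ
      simp [this]
  rw [← e2, e]
  exact h.functional_nonneg fun x _ => by rw [eval_mul]; exact mul_self_nonneg _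

theorem gaussQuad_nonneg (h : IsQuadWeight wt) {n : ℕ} {Φ : ℝ → ℝ}
    (hΦ : ∀ x ∈ Set.Ioo (0 : ℝ) 1, 0 ≤ Φ x) : 0 ≤ gaussQuad wt n Φ :=
  Finset.sum_nonneg fun ξ hξ =>
    mul_nonneg (h.gaussWeight_nonneg hξ) (hΦ ξ (h.mem_Ioo_of_mem_gaussNodes hξ))

theorem gaussQuad_mono (h : IsQuadWeight wt) {n : ℕ} {Φ Ψ : ℝ → ℝ}
    (hΦ : ∀ x ∈ Set.Ioo (0 : ℝ) 1, Φ x ≤ Ψ x) : gaussQuad wt n Φ ≤ gaussQuad wt n Ψ :=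
  Finset.sum_le_sum fun ξ hξ =>
    mul_le_mul_of_nonneg_left (hΦ ξ (h.mem_Ioo_of_mem_gaussNodes hξ)) (h.gaussWeight_nonneg hξ)

theorem gaussQuad_congr (h : IsQuadWeight wt) {n : ℕ} {Φ Ψ : ℝ → ℝ}
    (hΦ : ∀ x ∈ Set.Ioo (0 : ℝ) 1, Φ x = Ψ x) : gaussQuad wt n Φ = gaussQuad wt n Ψ :=
  Finset.sum_congr rfl fun ξ hξ => by rw [hΦ ξ (h.mem_Ioo_of_mem_gaussNodes hξ)]

end IsQuadWeight

theorem gaussQuad_const_mul (wt : ℝ → ℝ) (n : ℕ) (c : ℝ) (Φ : ℝ → ℝ) :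
    gaussQuad wt n (fun x => c * Φ x) = c * gaussQuad wt n Φ := by
  simp only [gaussQuad, Finset.mul_sum]
  exact Finset.sum_congr rfl fun ξ _ => by ring

theorem isQuadWeight_one : IsQuadWeight fun _ => 1 :=
  ⟨fun _ _ => one_pos, intervalIntegrable_const⟩

theorem isQuadWeight_zero_left {β : ℝ} (hβ : -1 < β) :
    IsQuadWeight fun x => (1 - x) ^ (0 : ℝ) * x ^ β := by
  refine ⟨fun x hx => ?_, ?_⟩
  · rw [Real.rpow_zero, one_mul]; exact Real.rpow_pos_of_pos hx.1 _
  · simpa using intervalIntegral.intervalIntegrable_rpow' (a := 0) (b := 1) hβ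

theorem isQuadWeight_zero_right {α : ℝ} (hα : -1 < α) :
    IsQuadWeight fun x => (1 - x) ^ α * x ^ (0 : ℝ) := by
  refine ⟨fun x hx => ?_, ?_⟩
  · rw [Real.rpow_zero, mul_one]; exact Real.rpow_pos_of_pos (sub_pos.2 hx.2) _
  · have := (intervalIntegral.intervalIntegrable_rpow' (a := 0) (b := 1) hα).comp_sub_left 1
    simpa using this.symm

/-! ### Integrals of squares over nonpolynomial denominators, bounded by quadrature. -/

/-- `f` agrees on `(0,1)` with a polynomial of degree at most `p`. -/
def IsPolyOn (p : ℕ) (f : ℝ → ℝ) : Prop :=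
  ∃ q : ℝ[X], q.natDegree ≤ p ∧ ∀ t ∈ Set.Ioo (0 : ℝ) 1, f t = q.eval t

theorem IsQuadWeight.lintegral_sq_mul {wt : ℝ → ℝ} (h : IsQuadWeight wt) {p n : ℕ}
    (hn : p + 1 ≤ n) {f : ℝ → ℝ} (hf : IsPolyOn p f) :
    ∫⁻ t in Set.Ioo (0 : ℝ) 1, ENNReal.ofReal (f t ^ 2 * wt t)
      = ENNReal.ofReal (gaussQuad wt n fun t => f t ^ 2) := by
  obtain ⟨q, hq, e⟩ := hf
  have hdeg : (q * q).degree < (2 * n : ℕ) := by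
    refine lt_of_le_of_lt degree_le_natDegree ?_
    have := natDegree_mul_le (p := q) (q := q)
    exact_mod_cast (by omega : (q * q).natDegree < 2 * n)
  have e1 : (gaussQuad wt n fun t => f t ^ 2) = gaussQuad wt n fun t => (q * q).eval t :=
    h.gaussQuad_congr fun t ht => by rw [e t ht, eval_mul, sq]
  rw [e1, h.gaussQuad_exact hdeg, IsQuadWeight.functional_apply,
    intervalIntegral.integral_of_le zero_le_one, integral_Ioc_eq_integral_Ioo,
    ofReal_integral_eq_lintegral_ofReal]
  · refine setLIntegral_congr_fun measurableSet_Ioo fun t ht => ?_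
    simp only [e t ht, eval_mul, sq]
  · exact (intervalIntegrable_iff_integrableOn_Ioo_of_le zero_le_one).1
      (h.integrable_eval_mul (q * q))
  · filter_upwards [ae_restrict_mem measurableSet_Ioo] with t ht
    rw [eval_mul]
    exact mul_nonneg (mul_self_nonneg _) (h.pos t ht).le

theorem IsQuadWeight.aemeasurable_sq_mul {wt : ℝ → ℝ} (h : IsQuadWeight wt) {p : ℕ}
    {f : ℝ → ℝ} (hf : IsPolyOn p f) :
    AEMeasurable (fun t => ENNReal.ofReal (f t ^ 2 * wt t))
      (volume.restrict (Set.Ioo (0 : ℝ) 1)) := by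
  obtain ⟨q, hq, e⟩ := hf
  have h1 : AEMeasurable (fun t => (q * q).eval t * wt t)
      (volume.restrict (Set.Ioo (0 : ℝ) 1)) :=
    ((intervalIntegrable_iff_integrableOn_Ioo_of_le zero_le_one).1
      (h.integrable_eval_mul (q * q))).aemeasurable
  refine h1.ennreal_ofReal.congr ?_
  filter_upwards [ae_restrict_mem measurableSet_Ioo] with t ht
  simp only [e t ht, eval_mul, sq]

theorem gaussQuad_comm (w₁ w₂ : ℝ → ℝ) (n : ℕ) (R : ℝ → ℝ → ℝ) :
    (gaussQuad w₁ n fun x => gaussQuad w₂ n fun y => R x y)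
      = gaussQuad w₂ n fun y => gaussQuad w₁ n fun x => R x y := by
  simp only [gaussQuad, Finset.mul_sum]
  rw [Finset.sum_comm]
  exact Finset.sum_congr rfl fun _ _ => Finset.sum_congr rfl fun _ _ => by ring

/-- One-dimensional exactness is used twice: in `y` for each fixed `x`, then in `x` at each node
`η`. Hence only the degree in each variable separately matters. -/
theorem lintegral_lintegral_sq_mul {w₁ w₂ : ℝ → ℝ} (h₁ : IsQuadWeight w₁) (h₂ : IsQuadWeight w₂)
    {p n : ℕ} (hn : p + 1 ≤ n) {S : ℝ → ℝ → ℝ}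
    (hx : ∀ x ∈ Set.Ioo (0 : ℝ) 1, IsPolyOn p fun y => S x y)
    (hy : ∀ y ∈ Set.Ioo (0 : ℝ) 1, IsPolyOn p fun x => S x y) :
    ∫⁻ x in Set.Ioo (0 : ℝ) 1, ∫⁻ y in Set.Ioo (0 : ℝ) 1,
        ENNReal.ofReal (S x y ^ 2 * (w₁ x * w₂ y))
      = ENNReal.ofReal (gaussQuad w₁ n fun x => gaussQuad w₂ n fun y => S x y ^ 2) := by
  have hin : ∀ x ∈ Set.Ioo (0 : ℝ) 1,
      ∫⁻ y in Set.Ioo (0 : ℝ) 1, ENNReal.ofReal (S x y ^ 2 * (w₁ x * w₂ y))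
        = ∑ η ∈ gaussNodes w₂ n,
            ENNReal.ofReal (gaussWeight w₂ n η) * ENNReal.ofReal (S x η ^ 2 * w₁ x) := by
    intro x hx'
    have h0 := (h₁.pos x hx').le
    have e1 : ∀ y, ENNReal.ofReal (S x y ^ 2 * (w₁ x * w₂ y))
        = ENNReal.ofReal (w₁ x) * ENNReal.ofReal (S x y ^ 2 * w₂ y) := fun y => by
      rw [← ENNReal.ofReal_mul h0]; congr 1; ring
    simp_rw [e1]
    rw [lintegral_const_mul' _ _ ENNReal.ofReal_ne_top, h₂.lintegral_sq_mul hn (hx x hx'),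
      gaussQuad, ENNReal.ofReal_sum_of_nonneg, Finset.mul_sum]
    · refine Finset.sum_congr rfl fun η hη => ?_
      rw [← ENNReal.ofReal_mul h0, ← ENNReal.ofReal_mul (h₂.gaussWeight_nonneg hη)]
      congr 1; ring
    · exact fun η hη => mul_nonneg (h₂.gaussWeight_nonneg hη) (sq_nonneg _)
  rw [setLIntegral_congr_fun measurableSet_Ioo hin, lintegral_finsetSum', gaussQuad_comm]
  · conv_rhs => rw [gaussQuad]
    rw [ENNReal.ofReal_sum_of_nonneg]
    · refine Finset.sum_congr rfl fun η hη => ?_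
      rw [lintegral_const_mul' _ _ ENNReal.ofReal_ne_top,
        h₁.lintegral_sq_mul hn (hy η (h₂.mem_Ioo_of_mem_gaussNodes hη)),
        ← ENNReal.ofReal_mul (h₂.gaussWeight_nonneg hη)]
    · exact fun η hη => mul_nonneg (h₂.gaussWeight_nonneg hη)
        (h₁.gaussQuad_nonneg fun _ _ => sq_nonneg _)
  · exact fun η hη =>
      (h₁.aemeasurable_sq_mul (hy η (h₂.mem_Ioo_of_mem_gaussNodes hη))).const_mul _

theorem div_rpow_le_rpow_mul_div {lo K D a A : ℝ} (hlo : 0 < lo) (hK : 0 < K) (ha : 0 ≤ a)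
    (hA : 0 ≤ A) (hD : lo ≤ D) (hD' : D ≤ K * lo) :
    A / D ^ a ≤ (lo ^ a)⁻¹ * A ∧ (lo ^ a)⁻¹ * A ≤ K ^ a * (A / D ^ a) := by
  have h1 : lo ^ a ≤ D ^ a := Real.rpow_le_rpow hlo.le hD ha
  have h2 : D ^ a ≤ K ^ a * lo ^ a := by
    rw [← Real.mul_rpow hK.le hlo.le]
    exact Real.rpow_le_rpow (hlo.le.trans hD) hD' ha
  have h3 : 0 < lo ^ a := Real.rpow_pos_of_pos hlo a
  have h4 : 0 < D ^ a := h3.trans_le h1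
  constructor
  · rw [div_eq_inv_mul]; gcongr
  · rw [inv_mul_eq_div, mul_div_assoc', div_le_div_iff₀ h3 h4]
    nlinarith [mul_le_mul_of_nonneg_left h2 hA]

/-- Replace `D` by its lower bound `lo`, integrate the polynomial square exactly, and put `D` back
at the nodes. Monotonicity of the rule makes the last step legitimate and yields the loss `K ^ a`.
-/
theorem lintegral_le_gaussQuad {wt : ℝ → ℝ} (h : IsQuadWeight wt) {p n : ℕ} (hn : p + 1 ≤ n)
    {f D G : ℝ → ℝ} (hf : IsPolyOn p f) {lo K a : ℝ} (hlo : 0 < lo) (hK : 0 < K) (ha : 0 ≤ a)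
    (hD : ∀ t ∈ Set.Ioo (0 : ℝ) 1, lo ≤ D t ∧ D t ≤ K * lo)
    (hG : ∀ t ∈ Set.Ioo (0 : ℝ) 1, G t = f t ^ 2 / D t ^ a) :
    ∫⁻ t in Set.Ioo (0 : ℝ) 1, ENNReal.ofReal (G t * wt t)
      ≤ ENNReal.ofReal (K ^ a * gaussQuad wt n G) := by
  have h3 : 0 ≤ (lo ^ a)⁻¹ := inv_nonneg.2 (Real.rpow_pos_of_pos hlo a).le
  calc ∫⁻ t in Set.Ioo (0 : ℝ) 1, ENNReal.ofReal (G t * wt t)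
      ≤ ∫⁻ t in Set.Ioo (0 : ℝ) 1,
          ENNReal.ofReal (lo ^ a)⁻¹ * ENNReal.ofReal (f t ^ 2 * wt t) := by
        refine setLIntegral_mono' measurableSet_Ioo fun t ht => ?_
        rw [← ENNReal.ofReal_mul h3, ← mul_assoc, hG t ht]
        exact ENNReal.ofReal_le_ofReal (mul_le_mul_of_nonneg_right
          (div_rpow_le_rpow_mul_div hlo hK ha (sq_nonneg _) (hD t ht).1 (hD t ht).2).1
          (h.pos t ht).le)
    _ = ENNReal.ofReal (gaussQuad wt n fun t => (lo ^ a)⁻¹ * f t ^ 2) := by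
        rw [lintegral_const_mul' _ _ ENNReal.ofReal_ne_top, h.lintegral_sq_mul hn hf,
          ← ENNReal.ofReal_mul h3, gaussQuad_const_mul]
    _ ≤ _ := by
        rw [← gaussQuad_const_mul]
        refine ENNReal.ofReal_le_ofReal (h.gaussQuad_mono fun t ht => ?_)
        rw [hG t ht]
        exact (div_rpow_le_rpow_mul_div hlo hK ha (sq_nonneg _) (hD t ht).1 (hD t ht).2).2

theorem lintegral_lintegral_le_gaussQuad {w₁ w₂ : ℝ → ℝ} (h₁ : IsQuadWeight w₁)
    (h₂ : IsQuadWeight w₂) {p n : ℕ} (hn : p + 1 ≤ n) {S D G : ℝ → ℝ → ℝ}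
    (hx : ∀ x ∈ Set.Ioo (0 : ℝ) 1, IsPolyOn p fun y => S x y)
    (hy : ∀ y ∈ Set.Ioo (0 : ℝ) 1, IsPolyOn p fun x => S x y)
    {lo K a : ℝ} (hlo : 0 < lo) (hK : 0 < K) (ha : 0 ≤ a)
    (hD : ∀ x ∈ Set.Ioo (0 : ℝ) 1, ∀ y ∈ Set.Ioo (0 : ℝ) 1, lo ≤ D x y ∧ D x y ≤ K * lo)
    (hG : ∀ x ∈ Set.Ioo (0 : ℝ) 1, ∀ y ∈ Set.Ioo (0 : ℝ) 1, G x y = S x y ^ 2 / D x y ^ a) :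
    ∫⁻ x in Set.Ioo (0 : ℝ) 1, ∫⁻ y in Set.Ioo (0 : ℝ) 1,
        ENNReal.ofReal (G x y * (w₁ x * w₂ y))
      ≤ ENNReal.ofReal (K ^ a * gaussQuad w₁ n fun x => gaussQuad w₂ n fun y => G x y) := by
  have h3 : 0 ≤ (lo ^ a)⁻¹ := inv_nonneg.2 (Real.rpow_pos_of_pos hlo a).le
  calc ∫⁻ x in Set.Ioo (0 : ℝ) 1, ∫⁻ y in Set.Ioo (0 : ℝ) 1,
        ENNReal.ofReal (G x y * (w₁ x * w₂ y))
      ≤ ∫⁻ x in Set.Ioo (0 : ℝ) 1, ∫⁻ y in Set.Ioo (0 : ℝ) 1,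
          ENNReal.ofReal (lo ^ a)⁻¹ * ENNReal.ofReal (S x y ^ 2 * (w₁ x * w₂ y)) := by
        refine setLIntegral_mono' measurableSet_Ioo fun x hx' =>
          setLIntegral_mono' measurableSet_Ioo fun y hy' => ?_
        rw [← ENNReal.ofReal_mul h3, ← mul_assoc (lo ^ a)⁻¹, hG x hx' y hy']
        exact ENNReal.ofReal_le_ofReal (mul_le_mul_of_nonneg_right
          (div_rpow_le_rpow_mul_div hlo hK ha (sq_nonneg _) (hD x hx' y hy').1
            (hD x hx' y hy').2).1 (mul_nonneg (h₁.pos x hx').le (h₂.pos y hy').le))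
    _ = ENNReal.ofReal
          (gaussQuad w₁ n fun x => gaussQuad w₂ n fun y => (lo ^ a)⁻¹ * S x y ^ 2) := by
        simp_rw [lintegral_const_mul' _ _ ENNReal.ofReal_ne_top]
        rw [lintegral_lintegral_sq_mul h₁ h₂ hn hx hy, ← ENNReal.ofReal_mul h3]
        simp_rw [gaussQuad_const_mul]
    _ ≤ _ := by
        simp_rw [← gaussQuad_const_mul]
        refine ENNReal.ofReal_le_ofReal (h₁.gaussQuad_mono fun x hx' =>
          h₂.gaussQuad_mono fun y hy' => ?_)
        rw [hG x hx' y hy']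
        exact (div_rpow_le_rpow_mul_div hlo hK ha (sq_nonneg _) (hD x hx' y hy').1
          (hD x hx' y hy').2).2

/-! Changes of variables. -/

theorem lintegral_Ioo_scale (a b : ℝ) (hab : a < b) (g : ℝ → ℝ≥0∞) :
    ∫⁻ y in Set.Ioo a b, g y
      = ENNReal.ofReal (b - a) * ∫⁻ t in Set.Ioo (0 : ℝ) 1, g (a + t * (b - a)) := by
  have hc : 0 < b - a := sub_pos.2 hab
  have himg : (fun t : ℝ => a + t * (b - a)) '' Set.Ioo (0 : ℝ) 1 = Set.Ioo a b := by
    ext y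
    constructor
    · rintro ⟨t, ⟨h0, h1⟩, rfl⟩
      constructor <;> dsimp only <;> nlinarith
    · rintro ⟨h0, h1⟩
      refine ⟨(y - a) / (b - a), ⟨div_pos (by linarith) hc, (div_lt_one hc).2 (by linarith)⟩, ?_⟩
      dsimp only
      rw [div_mul_cancel₀ _ hc.ne']; ring
  rw [← himg, lintegral_image_eq_lintegral_abs_deriv_mul (f' := fun _ => b - a) measurableSet_Ioo
    (fun x _ => ?_) (fun x _ y _ e => ?_), abs_of_pos hc,
    lintegral_const_mul' _ _ ENNReal.ofReal_ne_top]
  · simpa using (((hasDerivAt_id x).mul_const (b - a)).const_add a).hasDerivWithinAt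
  · exact mul_right_cancel₀ hc.ne' (add_left_cancel e)

theorem lintegral_Ioo_reflect (g : ℝ → ℝ≥0∞) :
    ∫⁻ t in Set.Ioo (0 : ℝ) 1, g t = ∫⁻ t in Set.Ioo (0 : ℝ) 1, g (1 - t) := by
  have himg : (fun t : ℝ => 1 - t) '' Set.Ioo (0 : ℝ) 1 = Set.Ioo 0 1 := by
    simp
  conv_lhs => rw [← himg]
  rw [lintegral_image_eq_lintegral_abs_deriv_mul (f' := fun _ => -1) measurableSet_Ioo
    (fun x _ => ?_) (fun x _ y _ e => ?_)]
  · simp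
  · simpa using ((hasDerivAt_id x).const_sub 1).hasDerivWithinAt
  · exact sub_right_injective e

/-- The Duffy transformation of the unit square. -/
theorem lintegral_lintegral_duffy {F : ℝ → ℝ → ℝ≥0∞} (hF : Measurable (Function.uncurry F)) :
    ∫⁻ x in Set.Ioo (0 : ℝ) 1, ∫⁻ y in Set.Ioo (0 : ℝ) 1, F x y
      = (∫⁻ x in Set.Ioo (0 : ℝ) 1, ∫⁻ y in Set.Ioo (0 : ℝ) 1, ENNReal.ofReal x * F x (x * y))
        + ∫⁻ y in Set.Ioo (0 : ℝ) 1, ∫⁻ x in Set.Ioo (0 : ℝ) 1,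
            ENNReal.ofReal y * F (x * y) y := by
  -- The square is cut along its diagonal, a null set; each triangle is scaled back to the square,
  -- with Jacobian `x` or `y`.
  set F₁ : ℝ → ℝ → ℝ≥0∞ := fun x => (Set.Iio x).indicator (F x)
  set F₂ : ℝ → ℝ → ℝ≥0∞ := fun x => (Set.Ioi x).indicator (F x)
  have hF₁ : Measurable (Function.uncurry F₁) :=
    hF.indicator (measurableSet_lt measurable_snd measurable_fst)
  have hF₂ : Measurable (Function.uncurry F₂) :=
    hF.indicator (measurableSet_lt measurable_fst measurable_snd)
  have hscale : ∀ x ∈ Set.Ioo (0 : ℝ) 1, ∀ g : ℝ → ℝ≥0∞,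
      ∫⁻ y in Set.Ioo (0 : ℝ) 1, (Set.Iio x).indicator g y
        = ∫⁻ y in Set.Ioo (0 : ℝ) 1, ENNReal.ofReal x * g (y * x) := by
    intro x hx g
    rw [setLIntegral_indicator measurableSet_Iio, Set.inter_comm, Set.Ioo_inter_Iio,
      min_eq_right hx.2.le, lintegral_Ioo_scale 0 x hx.1,
      lintegral_const_mul' _ _ ENNReal.ofReal_ne_top]
    simp
  have hsplit : ∀ x, ∫⁻ y in Set.Ioo (0 : ℝ) 1, F x y
      = (∫⁻ y in Set.Ioo (0 : ℝ) 1, F₁ x y) + ∫⁻ y in Set.Ioo (0 : ℝ) 1, F₂ x y := by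
    intro x
    have hm : Measurable (F₁ x) := hF₁.comp measurable_prodMk_left
    rw [← lintegral_add_left hm]
    refine lintegral_congr_ae (ae_restrict_of_ae ?_)
    filter_upwards [compl_mem_ae_iff.2 (measure_singleton x)] with y hy
    rcases lt_or_gt_of_ne (show y ≠ x from hy) with h | h
    · simp [F₁, F₂, h, h.le]
    · simp [F₁, F₂, h, h.le]
  simp_rw [hsplit]
  have hm : Measurable fun x => ∫⁻ y in Set.Ioo (0 : ℝ) 1, F₁ x y := hF₁.lintegral_prod_right'
  rw [lintegral_add_left hm]
  congr 1
  · refine setLIntegral_congr_fun measurableSet_Ioo fun x hx => ?_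
    simp only [F₁, hscale x hx, mul_comm x]
  · rw [lintegral_lintegral_swap hF₂.aemeasurable]
    refine setLIntegral_congr_fun measurableSet_Ioo fun y hy => ?_
    rw [← hscale y hy (fun x => F x y)]
    rfl

/-! ### Continuous representatives of `H¹₀` functions. -/

/-- Functions in `H¹₀(-1,1)` have a continuous representative that vanishes at the end points. -/
theorem exists_continuousOn_of_mem_H10 {u : ℝ → ℝ} (hu : u ∈ H10) :
    ∃ U : ℝ → ℝ, ContinuousOn U (Set.Icc (-1) 1) ∧ U (-1) = 0 ∧ U 1 = 0 ∧
      u =ᵐ[volume.restrict Ω] U := by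
  obtain ⟨hu2, g, hg2, -, φ, hφ, hφu, hφg⟩ := hu
  have hle : (-1 : ℝ) ≤ 1 := by norm_num
  have hgi : IntegrableOn g (Set.Icc (-1) 1) := by
    rw [integrableOn_Icc_iff_integrableOn_Ioo]
    have : IsFiniteMeasure (volume.restrict Ω) := by unfold Ω; infer_instance
    exact hg2.integrable (by norm_num)
  have hφ1 : ∀ k, (φ k) (-1) = 0 ∧ (φ k) 1 = 0 := fun k =>
    ⟨image_eq_zero_of_notMem_tsupport fun h => by
      simpa [Ω] using (hφ k).2.2 h, image_eq_zero_of_notMem_tsupport fun h => by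
      simpa [Ω] using (hφ k).2.2 h⟩
  have hcd : ∀ k, Continuous (deriv (φ k)) := fun k =>
    (hφ k).1.continuous_deriv (by simp)
  -- The representative is the primitive of the weak derivative `g` from `-1`. The test functions
  -- converge to it pointwise, since their derivatives converge to `g` in `L²` and hence in `L¹` on
  -- the bounded interval.
  have hconv : ∀ x ∈ Set.Icc (-1 : ℝ) 1,
      Tendsto (fun k => φ k x) atTop (𝓝 (∫ t in (-1 : ℝ)..x, g t)) := by
    intro x hx
    rw [tendsto_iff_edist_tendsto_0]
    have hlim : Tendsto (fun k => eLpNorm (fun x => g x - deriv (φ k) x) 2 (volume.restrict Ω)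
        * (volume.restrict Ω) Set.univ ^ (1 / (1 : ℝ≥0∞).toReal - 1 / (2 : ℝ≥0∞).toReal))
        atTop (𝓝 0) := by
      have h := ENNReal.Tendsto.mul_const (b := (volume.restrict Ω) Set.univ ^
        (1 / (1 : ℝ≥0∞).toReal - 1 / (2 : ℝ≥0∞).toReal)) hφg (Or.inr ?_)
      · rwa [zero_mul] at h
      · refine ENNReal.rpow_ne_top_of_nonneg (by norm_num) ?_
        simp [Ω]
    refine tendsto_of_tendsto_of_tendsto_of_le_of_le tendsto_const_nhds hlim
      (fun _ => zero_le) fun k => ?_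
    have hgx : IntervalIntegrable g volume (-1) x := by
      rw [intervalIntegrable_iff_integrableOn_Icc_of_le hx.1]
      exact hgi.mono_set (Set.Icc_subset_Icc_right hx.2)
    have e : φ k x = ∫ t in (-1 : ℝ)..x, deriv (φ k) t := by
      rw [intervalIntegral.integral_deriv_eq_sub
        (fun y _ => ((hφ k).1.differentiable (by simp)) y)
        ((hcd k).intervalIntegrable _ _), (hφ1 k).1, sub_zero]
    have hm : AEStronglyMeasurable (fun x => g x - deriv (φ k) x) (volume.restrict Ω) :=
      hg2.1.sub (hcd k).aestronglyMeasurable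
    calc edist (φ k x) (∫ t in (-1 : ℝ)..x, g t)
        = ‖∫ t in (-1 : ℝ)..x, (g t - deriv (φ k) t)‖ₑ := by
          rw [intervalIntegral.integral_sub hgx ((hcd k).intervalIntegrable _ _), ← e,
            edist_comm, edist_eq_enorm_sub]
      _ ≤ ∫⁻ t in Set.Ioc (-1) x, ‖g t - deriv (φ k) t‖ₑ := by
          rw [intervalIntegral.integral_of_le hx.1]
          exact enorm_integral_le_lintegral_enorm _
      _ ≤ ∫⁻ t in Set.Ioc (-1) 1, ‖g t - deriv (φ k) t‖ₑ :=
          lintegral_mono_set (Set.Ioc_subset_Ioc_right hx.2)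
      _ = eLpNorm (fun x => g x - deriv (φ k) x) 1 (volume.restrict Ω) := by
          rw [eLpNorm_one_eq_lintegral_enorm, Ω, restrict_Ioo_eq_restrict_Ioc]
      _ ≤ _ := eLpNorm_le_eLpNorm_mul_rpow_measure_univ (by norm_num) hm
  refine ⟨fun x => ∫ t in (-1 : ℝ)..x, g t, ?_, ?_, ?_, ?_⟩
  · have := intervalIntegral.continuousOn_primitive_interval (a := -1) (b := 1) (f := g)
      (μ := volume) (by rwa [Set.uIcc_of_le hle])
    rwa [Set.uIcc_of_le hle] at this
  · simp
  -- The primitive vanishes at `1` as a limit of the values `φ k 1 = 0`.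
  · refine tendsto_nhds_unique (hconv 1 (by simp)) ?_
    simp [hφ1]
  -- Convergence to `u` in `L²` gives almost everywhere convergence along a subsequence, identifying
  -- `u` with the pointwise limit.
  · have hmeas : TendstoInMeasure (volume.restrict Ω) φ atTop u := by
      refine tendstoInMeasure_of_tendsto_eLpNorm (p := 2) (by norm_num)
        (fun k => (hφ k).1.continuous.aestronglyMeasurable) hu2.1 ?_
      refine hφu.congr fun k => ?_
      rw [← eLpNorm_neg]
      congr 1
      ext x
      simp
    obtain ⟨ns, hns, hae⟩ := hmeas.exists_seq_tendsto_ae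
    filter_upwards [hae, ae_restrict_mem measurableSet_Ioo] with x hx hxΩ
    exact tendsto_nhds_unique hx ((hconv x ⟨hxΩ.1.le, hxΩ.2.le⟩).comp hns.tendsto_atTop)

/-! ### Elementary mesh geometry. -/

namespace Mesh

variable (𝒯 : Mesh)

theorem left_lt_right (i : Fin 𝒯.M) : 𝒯.left i < 𝒯.right i :=
  𝒯.strictMono_node Fin.castSucc_lt_succ

theorem h_pos (i : Fin 𝒯.M) : 0 < 𝒯.h i := sub_pos.2 (𝒯.left_lt_right i)

theorem neg_one_le_left (i : Fin 𝒯.M) : -1 ≤ 𝒯.left i := by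
  rw [← 𝒯.node_zero]; exact 𝒯.strictMono_node.monotone (Fin.zero_le _)

theorem right_le_one (i : Fin 𝒯.M) : 𝒯.right i ≤ 1 := by
  rw [← 𝒯.node_last]; exact 𝒯.strictMono_node.monotone (Fin.le_last _)

theorem elem_subset (i : Fin 𝒯.M) : 𝒯.elem i ⊆ Ω :=
  Set.Ioo_subset_Ioo (𝒯.neg_one_le_left i) (𝒯.right_le_one i)

theorem right_eq_left {i j : Fin 𝒯.M} (hij : (i : ℕ) + 1 = j) : 𝒯.right i = 𝒯.left j := by
  unfold right left
  congr 1
  ext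
  simpa using hij

theorem left_eq_neg_one {i : Fin 𝒯.M} (hi : (i : ℕ) = 0) : 𝒯.left i = -1 := by
  rw [← 𝒯.node_zero]
  unfold left
  congr 1
  ext
  simpa using hi

theorem right_eq_one {i : Fin 𝒯.M} (hi : (i : ℕ) + 1 = 𝒯.M) : 𝒯.right i = 1 := by
  rw [← 𝒯.node_last]
  unfold right
  congr 1
  ext
  simpa using hi

theorem closure_elem (i : Fin 𝒯.M) : closure (𝒯.elem i) = Set.Icc (𝒯.left i) (𝒯.right i) :=
  closure_Ioo (𝒯.left_lt_right i).ne

/-- Up to a null set, `Ω` is covered by the elements. -/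
theorem ae_mem_iUnion_elem : ∀ᵐ x ∂volume.restrict Ω, x ∈ ⋃ i, 𝒯.elem i := by
  have hfin : ∀ᵐ x ∂(volume : Measure ℝ), x ∉ Set.range 𝒯.node :=
    compl_mem_ae_iff.2 ((Set.finite_range 𝒯.node).measure_zero volume)
  filter_upwards [ae_restrict_of_ae hfin, ae_restrict_mem measurableSet_Ioo] with x hx hxΩ
  by_contra hno
  simp only [Set.mem_iUnion, not_exists] at hno
  have key : ∀ k : Fin (𝒯.M + 1), 𝒯.node k < x := by
    intro k
    induction k using Fin.induction with
    | zero => rw [𝒯.node_zero]; exact hxΩ.1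
    | succ i ih =>
      by_contra hge
      exact hno i ⟨ih, lt_of_le_of_ne (not_lt.1 hge) fun e => hx ⟨_, e.symm⟩⟩
  have := key (Fin.last _)
  rw [𝒯.node_last] at this
  exact absurd this (not_lt.2 hxΩ.2.le)

end Mesh

/-! ### Polynomial pieces of a spline and their nodal conditions. -/

/-- The elementwise polynomials of a spline that vanishes at the end points of `Ω`, on the reference
element: they match at the interior nodes and vanish at the end points. -/
theorem exists_pieces {𝒯 : Mesh} {p : ℕ} {u : ℝ → ℝ} (hu : u ∈ spline0 𝒯 p) :
    ∃ P : Fin 𝒯.M → ℝ[X], (∀ i, (P i).natDegree ≤ p) ∧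
      (∀ i, ∀ t ∈ Set.Ioo (0 : ℝ) 1, 𝒯.pull u i t = (P i).eval t) ∧
      (∀ i j : Fin 𝒯.M, (i : ℕ) + 1 = j → (P i).eval 1 = (P j).eval 0) ∧
      (∀ i : Fin 𝒯.M, (i : ℕ) = 0 → (P i).eval 0 = 0) ∧
      (∀ i : Fin 𝒯.M, (i : ℕ) + 1 = 𝒯.M → (P i).eval 1 = 0) := by
  obtain ⟨⟨-, hp⟩, h0⟩ := hu
  choose R hRdeg hR using hp
  obtain ⟨U, hUc, hU0, hU1, hUae⟩ := exists_continuousOn_of_mem_H10 h0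
  -- Values of `u` at the nodes are arbitrary, so matching must be read off from `U`: almost
  -- everywhere agreement on an open element extends by continuity to its closure.
  have hUR : ∀ i, Set.EqOn U (fun x => (R i).eval x) (Set.Icc (𝒯.left i) (𝒯.right i)) := by
    intro i
    have hsub : Set.Icc (𝒯.left i) (𝒯.right i) ⊆ Set.Icc (-1) 1 :=
      Set.Icc_subset_Icc (𝒯.neg_one_le_left i) (𝒯.right_le_one i)
    have hopen : Set.EqOn U (fun x => (R i).eval x) (𝒯.elem i) := by
      refine Measure.eqOn_open_of_ae_eq (μ := volume) ?_ isOpen_Ioo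
        (hUc.mono (Set.Ioo_subset_Icc_self.trans hsub)) (R i).continuous.continuousOn
      filter_upwards [ae_restrict_of_ae_restrict_of_subset (𝒯.elem_subset i) hUae,
        ae_restrict_mem measurableSet_Ioo] with x hx hx'
      rw [← hx, hR i x hx']
    rw [← 𝒯.closure_elem i]
    refine Set.EqOn.of_subset_closure hopen ?_ (R i).continuous.continuousOn subset_closure
      subset_rfl
    rw [𝒯.closure_elem i]
    exact hUc.mono hsub
  have hl : ∀ i, (R i).eval (𝒯.left i) = U (𝒯.left i) := fun i =>
    (hUR i (Set.left_mem_Icc.2 (𝒯.left_lt_right i).le)).symm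
  have hr : ∀ i, (R i).eval (𝒯.right i) = U (𝒯.right i) := fun i =>
    (hUR i (Set.right_mem_Icc.2 (𝒯.left_lt_right i).le)).symm
  have heval : ∀ i t, ((R i).comp (C (𝒯.left i) + X * C (𝒯.h i))).eval t
      = (R i).eval (𝒯.left i + t * 𝒯.h i) := fun i t => by
    rw [eval_comp, eval_add, eval_mul, eval_X, eval_C, eval_C]
  have he1 : ∀ i, 𝒯.left i + 1 * 𝒯.h i = 𝒯.right i := fun i => by simp [Mesh.h]
  refine ⟨fun i => (R i).comp (C (𝒯.left i) + X * C (𝒯.h i)), ?_, ?_, ?_, ?_, ?_⟩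
  · intro i
    rw [natDegree_comp]
    have : (C (𝒯.left i) + X * C (𝒯.h i)).natDegree ≤ 1 := by compute_degree
    exact (Nat.mul_le_mul (hRdeg i) this).trans (mul_one p).le
  · intro i t ht
    rw [heval, Mesh.pull, hR i]
    have := 𝒯.h_pos i
    have e : 𝒯.right i = 𝒯.left i + 𝒯.h i := by simp [Mesh.h]
    constructor
    · nlinarith [ht.1]
    · rw [e]; nlinarith [ht.2]
  · intro i j hij
    rw [heval, heval, he1, hr, 𝒯.right_eq_left hij, zero_mul, add_zero, hl]
  · intro i hi
    rw [heval, zero_mul, add_zero, hl, 𝒯.left_eq_neg_one hi, hU0]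
  · intro i hi
    rw [heval, he1, hr, 𝒯.right_eq_one hi, hU1]

/-! ### Quotients that remain polynomial. -/

theorem exists_eval_eq_sub_mul {p : ℕ} {q : ℝ[X]} (hq : q.natDegree ≤ p) {a : ℝ}
    (ha : q.eval a = 0) :
    ∃ r : ℝ[X], r.natDegree ≤ p ∧ ∀ t, q.eval t = (t - a) * r.eval t := by
  refine ⟨q /ₘ (X - C a), ?_, fun t => ?_⟩
  · rw [natDegree_divByMonic _ (monic_X_sub_C a)]; omega
  · conv_lhs => rw [← mul_divByMonic_eq_iff_isRoot.2 ha]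
    simp

theorem natDegree_comp_le_of_le_one {p : ℕ} {q r : ℝ[X]} (hq : q.natDegree ≤ p)
    (hr : r.natDegree ≤ 1) : (q.comp r).natDegree ≤ p := by
  rw [natDegree_comp]
  exact (Nat.mul_le_mul hq hr).trans (mul_one p).le

theorem IsPolyOn.eval_comp {p : ℕ} {q : ℝ[X]} (hq : q.natDegree ≤ p) (a b : ℝ) :
    IsPolyOn p fun t => q.eval (a + b * t) :=
  ⟨q.comp (C a + C b * X), natDegree_comp_le_of_le_one hq (by compute_degree), fun t _ => by simp⟩

theorem IsPolyOn.const (p : ℕ) (c : ℝ) : IsPolyOn p fun _ => c :=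
  ⟨C c, by simp, fun t _ => by simp⟩

theorem IsPolyOn.sub {p : ℕ} {f g : ℝ → ℝ} (hf : IsPolyOn p f) (hg : IsPolyOn p g) :
    IsPolyOn p fun t => f t - g t := by
  obtain ⟨q, hq, e⟩ := hf
  obtain ⟨r, hr, e'⟩ := hg
  exact ⟨q - r, (natDegree_sub_le _ _).trans (max_le hq hr), fun t ht => by
    simp [e t ht, e' t ht]⟩

theorem IsPolyOn.div_const {p : ℕ} {f : ℝ → ℝ} (hf : IsPolyOn p f) (c : ℝ) :
    IsPolyOn p fun t => f t / c := by
  obtain ⟨q, hq, e⟩ := hf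
  exact ⟨C c⁻¹ * q, (natDegree_C_mul_le _ _).trans hq, fun t ht => by
    simp [e t ht, div_eq_inv_mul]⟩

theorem IsPolyOn.congr {p : ℕ} {f g : ℝ → ℝ} (hf : IsPolyOn p f)
    (h : ∀ t ∈ Set.Ioo (0 : ℝ) 1, g t = f t) : IsPolyOn p g := by
  obtain ⟨q, hq, e⟩ := hf
  exact ⟨q, hq, fun t ht => (h t ht).trans (e t ht)⟩

/-- Division of a polynomial by a linear factor at an end point of `(0,1)`. -/
theorem IsPolyOn.eval_div_sub {p : ℕ} {q : ℝ[X]} (hq : q.natDegree ≤ p) {a : ℝ}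
    (ha : q.eval a = 0) (ha' : a ∉ Set.Ioo (0 : ℝ) 1) :
    IsPolyOn p fun t => q.eval t / (t - a) := by
  obtain ⟨r, hr, e⟩ := exists_eval_eq_sub_mul hq ha
  refine ⟨r, hr, fun t ht => ?_⟩
  have : t - a ≠ 0 := sub_ne_zero.2 fun h => ha' (h ▸ ht)
  dsimp only
  rw [e, mul_div_cancel_left₀ _ this]

/-- Difference quotients along the diagonal. -/
theorem isPolyOn_diffQuot_right {p : ℕ} {P : ℝ[X]} (hP : P.natDegree ≤ p) (x : ℝ) :
    IsPolyOn p fun y => (P.eval x - P.eval (x * y)) / (x - x * y) := by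
  have h1 : (C (P.eval x) - P.comp (C x * X)).natDegree ≤ p :=
    (natDegree_sub_le _ _).trans (max_le (by simp)
      (natDegree_comp_le_of_le_one hP (by compute_degree)))
  refine ((IsPolyOn.eval_div_sub h1 (a := 1) (by simp) (by simp)).div_const (-x)).congr
    fun t _ => ?_
  rw [div_div]
  congr 1
  · simp
  · ring

/-- As a polynomial in `x`, the numerator vanishes at `0`, where both terms equal `P.eval 0`; the
rest of the denominator, `1 - y`, is constant. -/
theorem isPolyOn_diffQuot_left {p : ℕ} {P : ℝ[X]} (hP : P.natDegree ≤ p) (y : ℝ) :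
    IsPolyOn p fun x => (P.eval x - P.eval (x * y)) / (x - x * y) := by
  have h1 : (P - P.comp (X * C y)).natDegree ≤ p :=
    (natDegree_sub_le _ _).trans (max_le hP
      (natDegree_comp_le_of_le_one hP (by compute_degree)))
  refine ((IsPolyOn.eval_div_sub h1 (a := 0) (by simp) (by simp)).div_const (1 - y)).congr
    fun t _ => ?_
  rw [div_div]
  congr 1
  · simp only [eval_sub, eval_comp, eval_mul, eval_C, eval_X]
  · ring

/-- Difference quotients of two polynomials that match at a common vertex. -/
theorem isPolyOn_vertexQuot_left {p : ℕ} {P R : ℝ[X]} (hP : P.natDegree ≤ p)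
    (hR : R.natDegree ≤ p) (h : P.eval 1 = R.eval 0) (y z : ℝ) :
    IsPolyOn p fun x => (P.eval (1 - x * z) - R.eval (x * y)) / x := by
  have h1 : (P.comp (C 1 - X * C z) - R.comp (X * C y)).natDegree ≤ p :=
    (natDegree_sub_le _ _).trans (max_le
      (natDegree_comp_le_of_le_one hP (by compute_degree))
      (natDegree_comp_le_of_le_one hR (by compute_degree)))
  refine (IsPolyOn.eval_div_sub h1 (a := 0) (by simp [h]) (by simp)).congr fun t _ => ?_
  congr 1
  · simp only [eval_sub, eval_comp, eval_mul, eval_C, eval_X]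
  · ring

/-! ### Bounds for single elements and pairs of elements. -/

section Elementwise

variable {𝒯 : Mesh} {s γ : ℝ} {p n : ℕ} {u : ℝ → ℝ} {P : Fin 𝒯.M → ℝ[X]}

theorem lintegral_elem (g : ℝ → ℝ≥0∞) (i : Fin 𝒯.M) :
    ∫⁻ x in 𝒯.elem i, g x
      = ENNReal.ofReal (𝒯.h i) * ∫⁻ t in Set.Ioo (0 : ℝ) 1, g (𝒯.left i + t * 𝒯.h i) :=
  lintegral_Ioo_scale _ _ (𝒯.left_lt_right i) g

theorem lintegral_elem_elem
    (hP : ∀ i, ∀ t ∈ Set.Ioo (0 : ℝ) 1, 𝒯.pull u i t = (P i).eval t) (i j : Fin 𝒯.M) :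
    ∫⁻ x in 𝒯.elem i, ∫⁻ y in 𝒯.elem j, ENNReal.ofReal (|u x - u y| ^ 2 / |x - y| ^ (1 + 2 * s))
      = ENNReal.ofReal (𝒯.h i * 𝒯.h j) *
        ∫⁻ x in Set.Ioo (0 : ℝ) 1, ∫⁻ y in Set.Ioo (0 : ℝ) 1,
          ENNReal.ofReal (((P i).eval x - (P j).eval y) ^ 2
            / |𝒯.left i + x * 𝒯.h i - (𝒯.left j + y * 𝒯.h j)| ^ (1 + 2 * s)) := by
  simp_rw [lintegral_elem]
  rw [lintegral_const_mul' _ _ ENNReal.ofReal_ne_top, ← mul_assoc,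
    ← ENNReal.ofReal_mul (𝒯.h_pos i).le]
  congr 1
  refine setLIntegral_congr_fun measurableSet_Ioo fun x hx =>
    setLIntegral_congr_fun measurableSet_Ioo fun y hy => ?_
  rw [← hP i x hx, ← hP j y hy, sq_abs]
  rfl

theorem measurable_kernel (Q R : ℝ[X]) (a b c d : ℝ) :
    Measurable (Function.uncurry fun x y : ℝ => ENNReal.ofReal ((Q.eval x - R.eval y) ^ 2
      / |a + x * b - (c + y * d)| ^ (1 + 2 * s))) := by
  have h1 : Measurable fun z : ℝ × ℝ => Q.eval z.1 := Q.continuous.measurable.comp measurable_fst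
  have h2 : Measurable fun z : ℝ × ℝ => R.eval z.2 := R.continuous.measurable.comp measurable_snd
  simp only [Function.uncurry_def]
  fun_prop

/-- The two Duffy triangles contribute equally by symmetry. With `S` the difference quotient,
Jacobian times kernel times `(x * (1 - y)) ^ 2` is exactly the weight `x ^ (2 - 2s) * (1 - y) ^ (1 -
2s)`, and the powers of `h` combine to `h ^ (1 - 2s)`. -/
theorem lintegral_ident_le (hs1 : s < 1) (hn : p + 1 ≤ n)
    (hdeg : ∀ i, (P i).natDegree ≤ p)
    (hP : ∀ i, ∀ t ∈ Set.Ioo (0 : ℝ) 1, 𝒯.pull u i t = (P i).eval t) (i : Fin 𝒯.M) :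
    ∫⁻ x in 𝒯.elem i, ∫⁻ y in 𝒯.elem i, ENNReal.ofReal (|u x - u y| ^ 2 / |x - y| ^ (1 + 2 * s))
      ≤ ENNReal.ofReal (Qident 𝒯 s n u u i) := by
  have hh := 𝒯.h_pos i
  have hxy : ∀ x ∈ Set.Ioo (0 : ℝ) 1, ∀ y ∈ Set.Ioo (0 : ℝ) 1, x * y ∈ Set.Ioo (0 : ℝ) 1 :=
    fun x hx y hy => ⟨mul_pos hx.1 hy.1, mul_lt_one_of_nonneg_of_lt_one_left hx.1.le hx.2 hy.2.le⟩
  set G : ℝ → ℝ → ℝ := fun x y =>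
    (𝒯.pull u i x - 𝒯.pull u i (x * y)) * (𝒯.pull u i x - 𝒯.pull u i (x * y)) / |x - x * y| ^ 2
    with hG
  set I := ∫⁻ x in Set.Ioo (0 : ℝ) 1, ∫⁻ y in Set.Ioo (0 : ℝ) 1,
    ENNReal.ofReal (G x y * ((1 - x) ^ (0 : ℝ) * x ^ (2 - 2 * s)
      * ((1 - y) ^ (1 - 2 * s) * y ^ (0 : ℝ)))) with hI
  have hIle : I ≤ ENNReal.ofReal (1 ^ (0 : ℝ) *
      gaussJacobi 0 (2 - 2 * s) n fun x => gaussJacobi (1 - 2 * s) 0 n fun y => G x y) := by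
    refine lintegral_lintegral_le_gaussQuad
      (isQuadWeight_zero_left (by linarith)) (isQuadWeight_zero_right (by linarith)) hn
      -- No denominator remains, so `D = 1` with exponent `0` and nothing is lost.
      (S := fun x y => ((P i).eval x - (P i).eval (x * y)) / (x - x * y)) (D := fun _ _ => 1)
      (fun x _ => isPolyOn_diffQuot_right (hdeg i) x)
      (fun y _ => isPolyOn_diffQuot_left (hdeg i) y) one_pos one_pos le_rfl
      (fun x _ y _ => by simp) fun x hx y hy => ?_
    simp only [hG, hP i x hx, hP i _ (hxy x hx y hy), sq_abs, Real.rpow_zero, div_one, div_pow, ← sq]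
  have hhalf : ENNReal.ofReal (𝒯.h i * 𝒯.h i) *
      (∫⁻ x in Set.Ioo (0 : ℝ) 1, ∫⁻ y in Set.Ioo (0 : ℝ) 1, ENNReal.ofReal x *
        ENNReal.ofReal (((P i).eval x - (P i).eval (x * y)) ^ 2
            / |𝒯.left i + x * 𝒯.h i - (𝒯.left i + x * y * 𝒯.h i)| ^ (1 + 2 * s)))
      = ENNReal.ofReal (𝒯.h i ^ (1 - 2 * s)) * I := by
    simp_rw [hI, ← lintegral_const_mul' _ _ ENNReal.ofReal_ne_top]
    refine setLIntegral_congr_fun measurableSet_Ioo fun x hx =>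
      setLIntegral_congr_fun measurableSet_Ioo fun y hy => ?_
    have hy1 : 0 < 1 - y := sub_pos.2 hy.2
    have hx0 := hx.1
    rw [← ENNReal.ofReal_mul hx.1.le, ← ENNReal.ofReal_mul (mul_nonneg hh.le hh.le),
      ← ENNReal.ofReal_mul (Real.rpow_nonneg hh.le _)]
    congr 1
    have e1 : 𝒯.left i + x * 𝒯.h i - (𝒯.left i + x * y * 𝒯.h i) = 𝒯.h i * (x * (1 - y)) := by ring
    have e2 : x - x * y = x * (1 - y) := by ring
    have r1 : ∀ z : ℝ, 0 < z → z ^ (1 + 2 * s) = z * z ^ (2 * s) := fun z hz => by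
      rw [Real.rpow_add hz, Real.rpow_one]
    have r2 : ∀ z : ℝ, 0 < z → z ^ (1 - 2 * s) = z / z ^ (2 * s) := fun z hz => by
      rw [Real.rpow_sub hz, Real.rpow_one]
    have r3 : x ^ (2 - 2 * s) = x ^ 2 / x ^ (2 * s) := by
      rw [Real.rpow_sub hx0, Real.rpow_two]
    simp only [hG, hP i x hx, hP i _ (hxy x hx y hy), Real.rpow_zero, e1, e2]
    rw [abs_of_pos (by positivity), abs_of_pos (by positivity),
      Real.mul_rpow hh.le (by positivity), Real.mul_rpow hx0.le hy1.le, r1 _ hh, r1 _ hx0,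
      r1 _ hy1, r2 _ hh, r2 _ hy1, r3]
    have p1 := Real.rpow_pos_of_pos hh (2 * s)
    have p2 := Real.rpow_pos_of_pos hx0 (2 * s)
    have p3 := Real.rpow_pos_of_pos hy1 (2 * s)
    field_simp
  have hsym : ∀ x y : ℝ, ((P i).eval (x * y) - (P i).eval y) ^ 2
        / |𝒯.left i + x * y * 𝒯.h i - (𝒯.left i + y * 𝒯.h i)| ^ (1 + 2 * s)
      = ((P i).eval y - (P i).eval (y * x)) ^ 2
        / |𝒯.left i + y * 𝒯.h i - (𝒯.left i + y * x * 𝒯.h i)| ^ (1 + 2 * s) := fun x y => by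
    rw [abs_sub_comm, mul_comm x y]; ring
  rw [lintegral_elem_elem hP, lintegral_lintegral_duffy (measurable_kernel _ _ _ _ _ _), mul_add]
  simp_rw [hsym]
  rw [hhalf, ← two_mul]
  calc 2 * (ENNReal.ofReal (𝒯.h i ^ (1 - 2 * s)) * I)
      ≤ ENNReal.ofReal 2 * (ENNReal.ofReal (𝒯.h i ^ (1 - 2 * s)) *
        ENNReal.ofReal (1 ^ (0 : ℝ) *
      gaussJacobi 0 (2 - 2 * s) n fun x => gaussJacobi (1 - 2 * s) 0 n fun y => G x y)) := by
        rw [ENNReal.ofReal_ofNat]; gcongr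
    _ = _ := by
        rw [← ENNReal.ofReal_mul (Real.rpow_nonneg hh.le _), ← ENNReal.ofReal_mul zero_le_two,
          Real.one_rpow, one_mul, Qident, mul_assoc]

/-- For separated elements `|x - y|` lies between their distance and that distance plus both
lengths; no change beyond the affine maps is needed. -/
theorem lintegral_sep_le (hs0 : 0 < s) (hn : p + 1 ≤ n)
    (hdeg : ∀ i, (P i).natDegree ≤ p)
    (hP : ∀ i, ∀ t ∈ Set.Ioo (0 : ℝ) 1, 𝒯.pull u i t = (P i).eval t) {i j : Fin 𝒯.M}
    {K : ℝ} (hK : 0 < K) (hd : 0 < 𝒯.left j - 𝒯.right i)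
    (hd' : 𝒯.h i + (𝒯.left j - 𝒯.right i) + 𝒯.h j ≤ K * (𝒯.left j - 𝒯.right i)) :
    ∫⁻ x in 𝒯.elem i, ∫⁻ y in 𝒯.elem j, ENNReal.ofReal (|u x - u y| ^ 2 / |x - y| ^ (1 + 2 * s))
      ≤ ENNReal.ofReal (K ^ (1 + 2 * s) * Qsep 𝒯 s n u u i j) := by
  have hi := 𝒯.h_pos i
  have hj := 𝒯.h_pos j
  have main := lintegral_lintegral_le_gaussQuad isQuadWeight_one isQuadWeight_one hn
    (S := fun x y => (P i).eval x - (P j).eval y)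
    (D := fun x y => |(1 - x) * 𝒯.h i + (𝒯.left j - 𝒯.right i) + y * 𝒯.h j|)
    (G := fun x y => (𝒯.pull u i x - 𝒯.pull u j y) * (𝒯.pull u i x - 𝒯.pull u j y)
        / |(1 - x) * 𝒯.h i + (𝒯.left j - 𝒯.right i) + y * 𝒯.h j| ^ (1 + 2 * s))
    (fun x _ => (IsPolyOn.const p _).sub ⟨P j, hdeg j, fun _ _ => rfl⟩)
    (fun y _ => IsPolyOn.sub ⟨P i, hdeg i, fun _ _ => rfl⟩ (IsPolyOn.const p _))
    hd hK (a := 1 + 2 * s) (by positivity)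
    (fun x hx y hy => by
      have h1 : 0 ≤ (1 - x) * 𝒯.h i := mul_nonneg (sub_nonneg.2 hx.2.le) hi.le
      have h2 : 0 ≤ y * 𝒯.h j := mul_nonneg hy.1.le hj.le
      rw [abs_of_pos (by positivity)]
      constructor
      · linarith
      · nlinarith [hx.1, hy.2])
    (fun x hx y hy => by simp only [hP i x hx, hP j y hy, sq])
  rw [lintegral_elem_elem hP, Qsep, mul_left_comm,
    ENNReal.ofReal_mul (mul_nonneg hi.le hj.le)]
  refine mul_le_mul_right ?_ _
  refine le_trans (le_of_eq ?_) main
  refine setLIntegral_congr_fun measurableSet_Ioo fun x hx =>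
    setLIntegral_congr_fun measurableSet_Ioo fun y hy => ?_
  have e : 𝒯.left i + x * 𝒯.h i - (𝒯.left j + y * 𝒯.h j)
      = -((1 - x) * 𝒯.h i + (𝒯.left j - 𝒯.right i) + y * 𝒯.h j) := by
    simp only [Mesh.h]; ring
  simp only [hP i x hx, hP j y hy, e, abs_neg, sq, mul_one]

/-- Reflecting the left element moves the common node to the origin. The Duffy variable then factors
out of `|x - y|`, and together with the Jacobian and the square divided out of the numerator it
gives the weight exponent `1 - (1 + 2s) + 2 = 2 - 2s`. What remains lies between one element length
and the sum of both. -/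
theorem lintegral_adj_le (hs0 : 0 < s) (hs1 : s < 1) (hn : p + 1 ≤ n)
    (hdeg : ∀ i, (P i).natDegree ≤ p)
    (hP : ∀ i, ∀ t ∈ Set.Ioo (0 : ℝ) 1, 𝒯.pull u i t = (P i).eval t) {i j : Fin 𝒯.M}
    (hij : 𝒯.right i = 𝒯.left j) (hv : (P i).eval 1 = (P j).eval 0)
    {K : ℝ} (hK : 0 < K) (hd : 𝒯.h i + 𝒯.h j ≤ K * 𝒯.h i) (hd' : 𝒯.h i + 𝒯.h j ≤ K * 𝒯.h j) :
    ∫⁻ x in 𝒯.elem i, ∫⁻ y in 𝒯.elem j, ENNReal.ofReal (|u x - u y| ^ 2 / |x - y| ^ (1 + 2 * s))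
      ≤ ENNReal.ofReal (K ^ (1 + 2 * s) * Qadj 𝒯 s n u u i j) := by
  have hi := 𝒯.h_pos i
  have hj := 𝒯.h_pos j
  have hxy : ∀ x ∈ Set.Ioo (0 : ℝ) 1, ∀ y ∈ Set.Ioo (0 : ℝ) 1, x * y ∈ Set.Ioo (0 : ℝ) 1 :=
    fun x hx y hy => ⟨mul_pos hx.1 hy.1, mul_lt_one_of_nonneg_of_lt_one_left hx.1.le hx.2 hy.2.le⟩
  have hrefl : ∀ x ∈ Set.Ioo (0 : ℝ) 1, 1 - x ∈ Set.Ioo (0 : ℝ) 1 :=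
    fun x hx => ⟨sub_pos.2 hx.2, by linarith [hx.1]⟩
  have ha : 0 ≤ 1 + 2 * s := by positivity
  have r1 : ∀ z : ℝ, 0 < z → z ^ (1 + 2 * s) = z * z ^ (2 * s) := fun z hz => by
    rw [Real.rpow_add hz, Real.rpow_one]
  have r3 : ∀ z : ℝ, 0 < z → z ^ (2 - 2 * s) = z ^ 2 / z ^ (2 * s) := fun z hz => by
    rw [Real.rpow_sub hz, Real.rpow_two]
  have hJ : IsQuadWeight fun x => (1 - x) ^ (0 : ℝ) * x ^ (2 - 2 * s) :=
    isQuadWeight_zero_left (by linarith)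
  set G₁ : ℝ → ℝ → ℝ := fun x y =>
    (𝒯.pull u i (1 - x) - 𝒯.pull u j (x * y)) * (𝒯.pull u i (1 - x) - 𝒯.pull u j (x * y))
          / (|𝒯.h i + y * 𝒯.h j| ^ (1 + 2 * s) * x ^ 2) with hG₁
  set G₂ : ℝ → ℝ → ℝ := fun x y =>
    (𝒯.pull u i (1 - x * y) - 𝒯.pull u j y) * (𝒯.pull u i (1 - x * y) - 𝒯.pull u j y)
          / (|x * 𝒯.h i + 𝒯.h j| ^ (1 + 2 * s) * y ^ 2) with hG₂
  have main₁ := lintegral_lintegral_le_gaussQuad hJ isQuadWeight_one hn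
    (S := fun x y => ((P i).eval (1 - x) - (P j).eval (x * y)) / x)
    (D := fun x y => |𝒯.h i + y * 𝒯.h j|) (G := G₁)
    (fun x _ => (((IsPolyOn.const p _).sub
      ((IsPolyOn.eval_comp (hdeg j) 0 x).congr fun t _ => by simp))).div_const x)
    (fun y _ => (isPolyOn_vertexQuot_left (hdeg i) (hdeg j) hv y 1).congr fun t _ => by simp)
    hi hK ha
    (fun x hx y hy => by
      have h2 : 0 ≤ y * 𝒯.h j := mul_nonneg hy.1.le hj.le
      rw [abs_of_pos (by positivity)]
      constructor
      · linarith
      · nlinarith [hx.1, hy.2])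
    (fun x hx y hy => by
      simp only [hG₁, hP i _ (hrefl x hx), hP j _ (hxy x hx y hy), div_pow, div_div]
      rw [mul_comm (x ^ 2), sq (eval _ _ - _)])
  have main₂ := lintegral_lintegral_le_gaussQuad hJ isQuadWeight_one hn
    (S := fun y x => ((P i).eval (1 - x * y) - (P j).eval y) / y)
    (D := fun y x => |x * 𝒯.h i + 𝒯.h j|) (G := fun y x => G₂ x y)
    (fun y _ => (((IsPolyOn.eval_comp (hdeg i) 1 (-y)).congr fun t _ => by
      congr 1; ring).sub (IsPolyOn.const p _)).div_const y)
    (fun x _ => (isPolyOn_vertexQuot_left (hdeg i) (hdeg j) hv 1 x).congr fun t _ => by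
      simp [mul_comm])
    hj hK ha
    (fun y hy x hx => by
      have h2 : 0 ≤ x * 𝒯.h i := mul_nonneg hx.1.le hi.le
      rw [abs_of_pos (by positivity)]
      constructor
      · linarith
      · nlinarith [hx.2, hy.2])
    (fun y hy x hx => by
      simp only [hG₂, hP i _ (hrefl _ (hxy x hx y hy)), hP j y hy, div_pow, div_div]
      rw [mul_comm (y ^ 2), sq (eval _ _ - _)])
  -- The Duffy formula has the singular variable outermost, `Qadj` has it innermost.
  rw [gaussQuad_comm] at main₂
  have n₁ : 0 ≤ K ^ (1 + 2 * s) * gaussJacobi 0 (2 - 2 * s) n fun x =>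
      gaussLegendre n fun y => G₁ x y :=
    mul_nonneg (Real.rpow_nonneg hK.le _) (hJ.gaussQuad_nonneg fun x hx =>
      isQuadWeight_one.gaussQuad_nonneg fun y hy => div_nonneg (mul_self_nonneg _) (by positivity))
  have n₂ : 0 ≤ K ^ (1 + 2 * s) * gaussLegendre n fun x =>
      gaussJacobi 0 (2 - 2 * s) n fun y => G₂ x y :=
    mul_nonneg (Real.rpow_nonneg hK.le _) (isQuadWeight_one.gaussQuad_nonneg fun x hx =>
      hJ.gaussQuad_nonneg fun y hy => div_nonneg (mul_self_nonneg _) (by positivity))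
  have e0 : ∀ x y : ℝ, 𝒯.left i + (1 - x) * 𝒯.h i - (𝒯.left j + y * 𝒯.h j)
      = -(x * 𝒯.h i + y * 𝒯.h j) := fun x y => by
    rw [← hij]; simp only [Mesh.h]; ring
  have hF : Measurable (Function.uncurry fun x y : ℝ =>
      ENNReal.ofReal (((P i).eval (1 - x) - (P j).eval y) ^ 2
        / |𝒯.left i + (1 - x) * 𝒯.h i - (𝒯.left j + y * 𝒯.h j)| ^ (1 + 2 * s))) :=
    (measurable_kernel (P i) (P j) (𝒯.left i) (𝒯.h i) (𝒯.left j) (𝒯.h j)).comp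
      (g := Function.uncurry fun x y : ℝ => ENNReal.ofReal (((P i).eval x - (P j).eval y) ^ 2
        / |𝒯.left i + x * 𝒯.h i - (𝒯.left j + y * 𝒯.h j)| ^ (1 + 2 * s)))
      (f := fun z : ℝ × ℝ => (1 - z.1, z.2)) (by fun_prop)
  have f₁ : ∫⁻ x in Set.Ioo (0 : ℝ) 1, ∫⁻ y in Set.Ioo (0 : ℝ) 1, ENNReal.ofReal x *
        ENNReal.ofReal (((P i).eval (1 - x) - (P j).eval (x * y)) ^ 2
        / |𝒯.left i + (1 - x) * 𝒯.h i - (𝒯.left j + x * y * 𝒯.h j)| ^ (1 + 2 * s))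
      = ∫⁻ x in Set.Ioo (0 : ℝ) 1, ∫⁻ y in Set.Ioo (0 : ℝ) 1,
        ENNReal.ofReal (G₁ x y * ((1 - x) ^ (0 : ℝ) * x ^ (2 - 2 * s) * 1)) := by
    refine setLIntegral_congr_fun measurableSet_Ioo fun x hx =>
      setLIntegral_congr_fun measurableSet_Ioo fun y hy => ?_
    have hx0 := hx.1
    have hD : 0 < 𝒯.h i + y * 𝒯.h j := add_pos hi (mul_pos hy.1 hj)
    rw [← ENNReal.ofReal_mul hx0.le]
    congr 1
    simp only [hG₁, hP i _ (hrefl x hx), hP j _ (hxy x hx y hy), Real.rpow_zero, e0, abs_neg]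
    have e1 : x * 𝒯.h i + x * y * 𝒯.h j = x * (𝒯.h i + y * 𝒯.h j) := by ring
    rw [e1, abs_of_pos hD, abs_of_pos (mul_pos hx0 hD), Real.mul_rpow hx0.le hD.le, r1 x hx0,
      r3 x hx0]
    have p2 := Real.rpow_pos_of_pos hx0 (2 * s)
    have p3 := Real.rpow_pos_of_pos hD (1 + 2 * s)
    field_simp
  have f₂ : ∫⁻ y in Set.Ioo (0 : ℝ) 1, ∫⁻ x in Set.Ioo (0 : ℝ) 1, ENNReal.ofReal y *
        ENNReal.ofReal (((P i).eval (1 - x * y) - (P j).eval y) ^ 2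
        / |𝒯.left i + (1 - x * y) * 𝒯.h i - (𝒯.left j + y * 𝒯.h j)| ^ (1 + 2 * s))
      = ∫⁻ y in Set.Ioo (0 : ℝ) 1, ∫⁻ x in Set.Ioo (0 : ℝ) 1,
        ENNReal.ofReal (G₂ x y * ((1 - y) ^ (0 : ℝ) * y ^ (2 - 2 * s) * 1)) := by
    refine setLIntegral_congr_fun measurableSet_Ioo fun y hy =>
      setLIntegral_congr_fun measurableSet_Ioo fun x hx => ?_
    have hy0 := hy.1
    have hD : 0 < x * 𝒯.h i + 𝒯.h j := add_pos (mul_pos hx.1 hi) hj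
    rw [← ENNReal.ofReal_mul hy0.le]
    congr 1
    simp only [hG₂, hP i _ (hrefl _ (hxy x hx y hy)), hP j y hy, Real.rpow_zero, e0, abs_neg]
    have e1 : x * y * 𝒯.h i + y * 𝒯.h j = y * (x * 𝒯.h i + 𝒯.h j) := by ring
    rw [e1, abs_of_pos hD, abs_of_pos (mul_pos hy0 hD), Real.mul_rpow hy0.le hD.le, r1 y hy0,
      r3 y hy0]
    have p2 := Real.rpow_pos_of_pos hy0 (2 * s)
    have p3 := Real.rpow_pos_of_pos hD (1 + 2 * s)
    field_simp
  rw [lintegral_elem_elem hP, lintegral_Ioo_reflect, lintegral_lintegral_duffy hF, f₁, f₂, Qadj,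
    mul_left_comm, ENNReal.ofReal_mul (mul_nonneg hi.le hj.le), mul_add (K ^ (1 + 2 * s)),
    ENNReal.ofReal_add n₁ n₂]
  exact mul_le_mul_right (add_le_add main₁ main₂) _

/-- On the first element the zero at `-1` allows division by `x`, leaving the weight `x ^ (2 - 2s)`
and the constant `D = h`; on the others `1 + x` is comparable to the distance from `-1`. -/
theorem lintegral_left_le (hs0 : 0 < s) (hs1 : s < 1) (hn : p + 1 ≤ n)
    (hdeg : ∀ i, (P i).natDegree ≤ p)
    (hP : ∀ i, ∀ t ∈ Set.Ioo (0 : ℝ) 1, 𝒯.pull u i t = (P i).eval t) {i : Fin 𝒯.M}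
    (hv : (i : ℕ) = 0 → (P i).eval 0 = 0) {K : ℝ} (hK : 1 ≤ K)
    (hd : (i : ℕ) ≠ 0 → 0 < 𝒯.left i - (-1) ∧
      𝒯.left i - (-1) + 𝒯.h i ≤ K * (𝒯.left i - (-1))) :
    ∫⁻ x in 𝒯.elem i, ENNReal.ofReal (u x ^ 2 / |1 + x| ^ (2 * s))
      ≤ ENNReal.ofReal (K ^ (2 * s) * (𝒯.h i * if (i : ℕ) = 0 then
        gaussJacobi 0 (2 - 2 * s) n fun x => 𝒯.pull u i x * 𝒯.pull u i x / (x ^ 2 * 𝒯.h i ^ (2 * s))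
      else
        gaussLegendre n fun x => 𝒯.pull u i x * 𝒯.pull u i x
          / |(𝒯.left i - (-1)) + x * 𝒯.h i| ^ (2 * s))) := by
  have hi := 𝒯.h_pos i
  have hK0 : 0 < K := one_pos.trans_le hK
  rw [lintegral_elem, mul_left_comm, ENNReal.ofReal_mul hi.le]
  refine mul_le_mul_right ?_ _
  split_ifs with h0
  · have main := lintegral_le_gaussQuad
      (isQuadWeight_zero_left (β := 2 - 2 * s) (by linarith)) hn
      (f := fun t => (P i).eval t / t) (D := fun _ => 𝒯.h i)
      (G := fun x => 𝒯.pull u i x * 𝒯.pull u i x / (x ^ 2 * 𝒯.h i ^ (2 * s)))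
      ((IsPolyOn.eval_div_sub (hdeg i) (hv h0) (by simp)).congr fun t _ => by simp)
      hi hK0 (a := 2 * s) (by positivity) (fun t _ => ⟨le_rfl, le_mul_of_one_le_left hi.le hK⟩)
      (fun t ht => by simp only [hP i t ht, div_pow, div_div, ← sq])
    refine le_trans (le_of_eq (setLIntegral_congr_fun measurableSet_Ioo fun x hx => ?_)) main
    have hx0 := hx.1
    have e : 1 + (𝒯.left i + x * 𝒯.h i) = x * 𝒯.h i := by rw [𝒯.left_eq_neg_one h0]; ring
    have e2 : u (𝒯.left i + x * 𝒯.h i) = 𝒯.pull u i x := rfl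
    simp only [e, e2, Real.rpow_zero]
    rw [abs_of_pos (mul_pos hx0 hi), Real.mul_rpow hx0.le hi.le, Real.rpow_sub hx0, Real.rpow_two]
    congr 1
    have p2 := Real.rpow_pos_of_pos hx0 (2 * s)
    have p3 := Real.rpow_pos_of_pos hi (2 * s)
    field_simp
  · obtain ⟨hd1, hd2⟩ := hd h0
    have main := lintegral_le_gaussQuad isQuadWeight_one hn
      (f := fun t => (P i).eval t) (D := fun x => |(𝒯.left i - (-1)) + x * 𝒯.h i|)
      (G := fun x => 𝒯.pull u i x * 𝒯.pull u i x
          / |(𝒯.left i - (-1)) + x * 𝒯.h i| ^ (2 * s))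
      ⟨P i, hdeg i, fun _ _ => rfl⟩ hd1 hK0 (a := 2 * s) (by positivity)
      (fun t ht => by
        have h2 : 0 ≤ t * 𝒯.h i := mul_nonneg ht.1.le hi.le
        rw [abs_of_pos (by positivity)]
        constructor
        · linarith
        · nlinarith [ht.2])
      (fun t ht => by simp only [hP i t ht, sq])
    refine le_trans (le_of_eq (setLIntegral_congr_fun measurableSet_Ioo fun x hx => ?_)) main
    have e : 1 + (𝒯.left i + x * 𝒯.h i) = 𝒯.left i - (-1) + x * 𝒯.h i := by ring
    simp only [e, mul_one, sq]
    rfl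

theorem lintegral_right_le (hs0 : 0 < s) (hs1 : s < 1) (hn : p + 1 ≤ n)
    (hdeg : ∀ i, (P i).natDegree ≤ p)
    (hP : ∀ i, ∀ t ∈ Set.Ioo (0 : ℝ) 1, 𝒯.pull u i t = (P i).eval t) {i : Fin 𝒯.M}
    (hv : (i : ℕ) + 1 = 𝒯.M → (P i).eval 1 = 0) {K : ℝ} (hK : 1 ≤ K)
    (hd : (i : ℕ) + 1 ≠ 𝒯.M → 0 < 1 - 𝒯.right i ∧
      1 - 𝒯.right i + 𝒯.h i ≤ K * (1 - 𝒯.right i)) :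
    ∫⁻ x in 𝒯.elem i, ENNReal.ofReal (u x ^ 2 / |1 - x| ^ (2 * s))
      ≤ ENNReal.ofReal (K ^ (2 * s) * (𝒯.h i * if (i : ℕ) + 1 = 𝒯.M then
        gaussJacobi (2 - 2 * s) 0 n fun x =>
          𝒯.pull u i x * 𝒯.pull u i x / ((1 - x) ^ 2 * 𝒯.h i ^ (2 * s))
      else
        gaussLegendre n fun x => 𝒯.pull u i x * 𝒯.pull u i x
          / |(1 - 𝒯.right i) + (1 - x) * 𝒯.h i| ^ (2 * s))) := by
  have hi := 𝒯.h_pos i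
  have hK0 : 0 < K := one_pos.trans_le hK
  have e : ∀ x, 1 - (𝒯.left i + x * 𝒯.h i) = 1 - 𝒯.right i + (1 - x) * 𝒯.h i := fun x => by
    simp only [Mesh.h]; ring
  rw [lintegral_elem, mul_left_comm, ENNReal.ofReal_mul hi.le]
  refine mul_le_mul_right ?_ _
  split_ifs with h0
  · have main := lintegral_le_gaussQuad
      (isQuadWeight_zero_right (α := 2 - 2 * s) (by linarith)) hn
      (f := fun t => (P i).eval t / (t - 1)) (D := fun _ => 𝒯.h i)
      (G := fun x => 𝒯.pull u i x * 𝒯.pull u i x / ((1 - x) ^ 2 * 𝒯.h i ^ (2 * s)))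
      (IsPolyOn.eval_div_sub (hdeg i) (hv h0) (by simp))
      hi hK0 (a := 2 * s) (by positivity) (fun t _ => ⟨le_rfl, le_mul_of_one_le_left hi.le hK⟩)
      (fun t ht => by
        rw [hP i t ht, div_pow, div_div, ← sq, ← neg_sub 1 t, neg_sq])
    refine le_trans (le_of_eq (setLIntegral_congr_fun measurableSet_Ioo fun x hx => ?_)) main
    have hx0 : 0 < 1 - x := sub_pos.2 hx.2
    have e2 : u (𝒯.left i + x * 𝒯.h i) = 𝒯.pull u i x := rfl
    simp only [e, e2, Real.rpow_zero, 𝒯.right_eq_one h0, sub_self, zero_add]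
    rw [abs_of_pos (mul_pos hx0 hi), Real.mul_rpow hx0.le hi.le, Real.rpow_sub hx0, Real.rpow_two]
    congr 1
    have p2 := Real.rpow_pos_of_pos hx0 (2 * s)
    have p3 := Real.rpow_pos_of_pos hi (2 * s)
    field_simp
  · obtain ⟨hd1, hd2⟩ := hd h0
    have main := lintegral_le_gaussQuad isQuadWeight_one hn
      (f := fun t => (P i).eval t) (D := fun x => |(1 - 𝒯.right i) + (1 - x) * 𝒯.h i|)
      (G := fun x => 𝒯.pull u i x * 𝒯.pull u i x
          / |(1 - 𝒯.right i) + (1 - x) * 𝒯.h i| ^ (2 * s))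
      ⟨P i, hdeg i, fun _ _ => rfl⟩ hd1 hK0 (a := 2 * s) (by positivity)
      (fun t ht => by
        have h2 : 0 ≤ (1 - t) * 𝒯.h i := mul_nonneg (sub_nonneg.2 ht.2.le) hi.le
        rw [abs_of_pos (by positivity)]
        constructor
        · linarith
        · nlinarith [ht.1])
      (fun t ht => by simp only [hP i t ht, sq])
    refine le_trans (le_of_eq (setLIntegral_congr_fun measurableSet_Ioo fun x hx => ?_)) main
    simp only [e, mul_one, sq]
    rfl

end Elementwise

/-! ### The normalising constant, the boundary distance and shape regularity. -/

theorem fracConst_pos {s : ℝ} (hs0 : 0 < s) (hs1 : s < 1) : 0 < fracConst s := by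
  -- From `Γ(1 - s) = -s Γ(-s)` and `Γ(1 - s) > 0`.
  have h1 : Real.Gamma (-s) < 0 := by
    have h := Real.Gamma_add_one (neg_ne_zero.2 hs0.ne')
    have hp : 0 < Real.Gamma (-s + 1) := Real.Gamma_pos_of_pos (by linarith)
    by_contra! hge
    rw [h] at hp
    nlinarith
  have h2 : 0 < Real.Gamma (s + 1 / 2) := Real.Gamma_pos_of_pos (by linarith)
  have h3 : (0 : ℝ) < 2 ^ (2 * s) := Real.rpow_pos_of_pos two_pos _
  have h4 : 0 < Real.pi ^ (1 / 2 : ℝ) := Real.rpow_pos_of_pos Real.pi_pos _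
  rw [fracConst, neg_pos]
  exact div_neg_of_pos_of_neg (mul_pos h3 h2) (mul_neg_of_pos_of_neg h4 h1)

theorem bdist_eq_or {x : ℝ} (hx : x ∈ Ω) :
    (bdist x = 1 + x ∨ bdist x = 1 - x) ∧ bdist x ≤ 1 := by
  have hf : frontier Ω = {-1, 1} := frontier_Ioo (by norm_num)
  have d1 : dist x (-1) = 1 + x := by
    rw [Real.dist_eq, abs_of_pos (by linarith [hx.1])]; ring
  have d2 : dist x 1 = 1 - x := by
    rw [dist_comm, Real.dist_eq, abs_of_pos (by linarith [hx.2])]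
  rw [bdist, hf]
  constructor
  · obtain ⟨y, hy, e⟩ := ((Set.toFinite {-1, (1 : ℝ)}).isCompact).exists_infDist_eq_dist
      ⟨-1, by simp⟩ x
    rcases hy with rfl | rfl
    · exact Or.inl (e.trans d1)
    · exact Or.inr (e.trans d2)
  · have l1 : Metric.infDist x {-1, 1} ≤ 1 + x :=
      d1 ▸ Metric.infDist_le_dist_of_mem (by simp)
    have l2 : Metric.infDist x {-1, 1} ≤ 1 - x :=
      d2 ▸ Metric.infDist_le_dist_of_mem (by simp)
    linarith

theorem bdist_pos {x : ℝ} (hx : x ∈ Ω) : 0 < bdist x := by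
  rcases (bdist_eq_or hx).1 with h | h
  · rw [h]; linarith [hx.1]
  · rw [h]; linarith [hx.2]

theorem sq_abs_div_bdist {s : ℝ} {x : ℝ} (hx : x ∈ Ω) (a : ℝ) :
    |a / bdist x ^ s| ^ 2 = a ^ 2 / bdist x ^ (2 * s) := by
  rw [sq_abs, div_pow, mul_comm 2 s, Real.rpow_mul (bdist_pos hx).le, Real.rpow_two]

namespace Mesh

variable {𝒯 : Mesh} {γ : ℝ}

theorem ShapeRegular.h_le (h𝒯 : 𝒯.ShapeRegular γ) (hγ : 0 < γ) {i j : Fin 𝒯.M}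
    (hij : 𝒯.right i = 𝒯.left j) : 𝒯.h i ≤ 1 / γ * 𝒯.h j ∧ 𝒯.h j ≤ 1 / γ * 𝒯.h i := by
  have hi : 𝒯.right i ∈ closure (𝒯.elem i) := by
    rw [𝒯.closure_elem]; exact Set.right_mem_Icc.2 (𝒯.left_lt_right i).le
  have hj : 𝒯.right i ∈ closure (𝒯.elem j) := by
    rw [𝒯.closure_elem, hij]; exact Set.left_mem_Icc.2 (𝒯.left_lt_right j).le
  have h1 := h𝒯 i j ⟨_, hi, hj⟩
  have h2 := h𝒯 j i ⟨_, hj, hi⟩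
  rw [one_div_mul_eq_div, one_div_mul_eq_div, le_div_iff₀ hγ, le_div_iff₀ hγ]
  constructor <;> linarith

/-- In a shape regular mesh, an element is not much larger than its distance to a point on its
right that it does not touch. -/
theorem ShapeRegular.h_le_of_lt (h𝒯 : 𝒯.ShapeRegular γ) (hγ : 0 < γ) {i j : Fin 𝒯.M}
    (hij : i < j) : 𝒯.h i ≤ 1 / γ * (𝒯.right j - 𝒯.right i) ∧
      𝒯.h j ≤ 1 / γ * (𝒯.left j - 𝒯.left i) := by
  have hg : 0 ≤ 1 / γ := (one_div_pos.2 hγ).le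
  have hi : (i : ℕ) + 1 < 𝒯.M := lt_of_le_of_lt hij j.2
  have hj : (j : ℕ) - 1 < 𝒯.M := by omega
  constructor
  -- The right neighbour `k` of `i` fits between `right i` and `right j`, and its length is
  -- comparable to that of `i`.
  · set k : Fin 𝒯.M := ⟨i + 1, hi⟩
    have e : 𝒯.right i = 𝒯.left k := 𝒯.right_eq_left rfl
    have hk : 𝒯.right k ≤ 𝒯.right j :=
      𝒯.strictMono_node.monotone (by rw [Fin.le_def]; simpa [k] using hij)
    refine (h𝒯.h_le hγ e).1.trans (mul_le_mul_of_nonneg_left ?_ hg)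
    rw [Mesh.h, e]; linarith
  · set k : Fin 𝒯.M := ⟨j - 1, hj⟩
    have hlt : (i : ℕ) < j := hij
    have e : 𝒯.right k = 𝒯.left j := 𝒯.right_eq_left (by simp only [k]; omega)
    have hk : 𝒯.left i ≤ 𝒯.left k :=
      𝒯.strictMono_node.monotone (by rw [Fin.le_def]; simp [k]; omega)
    refine (h𝒯.h_le hγ e).2.trans (mul_le_mul_of_nonneg_left ?_ hg)
    rw [Mesh.h, e]; linarith

theorem lintegral_Ω_le (𝒯 : Mesh) (g : ℝ → ℝ≥0∞) :
    ∫⁻ x in Ω, g x ≤ ∑ i, ∫⁻ x in 𝒯.elem i, g x := by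
  calc ∫⁻ x in Ω, g x ≤ ∫⁻ x in ⋃ i, 𝒯.elem i, g x :=
        lintegral_mono_set' ((ae_restrict_iff' measurableSet_Ioo).1 𝒯.ae_mem_iUnion_elem)
    _ ≤ _ := (lintegral_iUnion_le _ _).trans (tsum_fintype _).le

end Mesh

/-! ### Nonnegativity, summation over elements and coercivity. -/

variable {𝒯 : Mesh} {s γ : ℝ} {n : ℕ} {u : ℝ → ℝ}

theorem gaussLegendre_nonneg {Φ : ℝ → ℝ} (hΦ : ∀ x ∈ Set.Ioo (0 : ℝ) 1, 0 ≤ Φ x) :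
    0 ≤ gaussLegendre n Φ :=
  isQuadWeight_one.gaussQuad_nonneg hΦ

theorem gaussJacobi_zero_left_nonneg {β : ℝ} (hβ : -1 < β) {Φ : ℝ → ℝ}
    (hΦ : ∀ x ∈ Set.Ioo (0 : ℝ) 1, 0 ≤ Φ x) : 0 ≤ gaussJacobi 0 β n Φ :=
  (isQuadWeight_zero_left hβ).gaussQuad_nonneg hΦ

theorem gaussJacobi_zero_right_nonneg {α : ℝ} (hα : -1 < α) {Φ : ℝ → ℝ}
    (hΦ : ∀ x ∈ Set.Ioo (0 : ℝ) 1, 0 ≤ Φ x) : 0 ≤ gaussJacobi α 0 n Φ :=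
  (isQuadWeight_zero_right hα).gaussQuad_nonneg hΦ

theorem Qident_nonneg (hs1 : s < 1) (i : Fin 𝒯.M) : 0 ≤ Qident 𝒯 s n u u i := by
  have hi := 𝒯.h_pos i
  refine mul_nonneg (by positivity) (gaussJacobi_zero_left_nonneg (by linarith) fun x _ =>
    gaussJacobi_zero_right_nonneg (by linarith) fun y _ =>
      div_nonneg (mul_self_nonneg _) (by positivity))

theorem Qadj_nonneg (hs1 : s < 1) (i j : Fin 𝒯.M) : 0 ≤ Qadj 𝒯 s n u u i j := by
  have hi := 𝒯.h_pos i
  have hj := 𝒯.h_pos j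
  refine mul_nonneg (by positivity) (add_nonneg
    (gaussJacobi_zero_left_nonneg (by linarith) fun x _ => gaussLegendre_nonneg fun y _ =>
      div_nonneg (mul_self_nonneg _) (by positivity))
    (gaussLegendre_nonneg fun x _ => gaussJacobi_zero_left_nonneg (by linarith) fun y _ =>
      div_nonneg (mul_self_nonneg _) (by positivity)))

theorem Qsep_nonneg (i j : Fin 𝒯.M) : 0 ≤ Qsep 𝒯 s n u u i j := by
  have hi := 𝒯.h_pos i
  have hj := 𝒯.h_pos j
  refine mul_nonneg (by positivity) (gaussLegendre_nonneg fun x _ => gaussLegendre_nonneg fun y _ =>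
      div_nonneg (mul_self_nonneg _) (by positivity))

theorem Qelem_nonneg (hs1 : s < 1) (i j : Fin 𝒯.M) : 0 ≤ Qelem 𝒯 s n u u i j := by
  unfold Qelem
  split_ifs
  exacts [Qident_nonneg hs1 i, Qadj_nonneg hs1 i j, Qadj_nonneg hs1 j i, Qsep_nonneg i j,
    Qsep_nonneg j i]

theorem Qelem_comm (i j : Fin 𝒯.M) : Qelem 𝒯 s n u u i j = Qelem 𝒯 s n u u j i := by
  rcases lt_trichotomy i j with h | rfl | h
  · have h' : (i : ℕ) < j := h
    have a1 : ¬ (j : ℕ) + 1 = i := by omega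
    simp [Qelem, h.ne, h.ne', h, h.not_gt, a1]
  · rfl
  · have h' : (j : ℕ) < i := h
    have a1 : ¬ (i : ℕ) + 1 = j := by omega
    simp [Qelem, h.ne, h.ne', h, h.not_gt, a1]

theorem aemeasurable_elem (hu : u ∈ H1) (i : Fin 𝒯.M) :
    AEMeasurable u (volume.restrict (𝒯.elem i)) :=
  hu.1.1.aemeasurable.mono_measure (Measure.restrict_mono (𝒯.elem_subset i) le_rfl)

theorem aemeasurable_slobodeckij (hu : u ∈ H1) (i j : Fin 𝒯.M) :
    AEMeasurable (Function.uncurry fun x y =>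
      ENNReal.ofReal (|u x - u y| ^ 2 / |x - y| ^ (1 + 2 * s)))
      ((volume.restrict (𝒯.elem i)).prod (volume.restrict (𝒯.elem j))) := by
  have h1 := (aemeasurable_elem (𝒯 := 𝒯) hu i).comp_quasiMeasurePreserving
    (Measure.quasiMeasurePreserving_fst (ν := volume.restrict (𝒯.elem j)))
  have h2 := (aemeasurable_elem (𝒯 := 𝒯) hu j).comp_quasiMeasurePreserving
    (Measure.quasiMeasurePreserving_snd (μ := volume.restrict (𝒯.elem i)))
  have h3 : Measurable fun z : ℝ × ℝ => |z.1 - z.2| ^ (1 + 2 * s) := by fun_prop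
  have h4 : AEMeasurable (fun z : ℝ × ℝ => |u z.1 - u z.2| ^ 2)
      ((volume.restrict (𝒯.elem i)).prod (volume.restrict (𝒯.elem j))) := by
    simp_rw [sq_abs]
    exact (h1.sub h2).pow_const 2
  exact (h4.div h3.aemeasurable).ennreal_ofReal

theorem lintegral_slobodeckij_comm (hu : u ∈ H1) (i j : Fin 𝒯.M) :
    ∫⁻ x in 𝒯.elem i, ∫⁻ y in 𝒯.elem j, ENNReal.ofReal (|u x - u y| ^ 2 / |x - y| ^ (1 + 2 * s))
      = ∫⁻ x in 𝒯.elem j, ∫⁻ y in 𝒯.elem i,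
        ENNReal.ofReal (|u x - u y| ^ 2 / |x - y| ^ (1 + 2 * s)) := by
  rw [lintegral_lintegral_swap (aemeasurable_slobodeckij hu i j)]
  simp_rw [abs_sub_comm]

theorem lintegral_elem_elem_le {p : ℕ} (hs0 : 0 < s) (hs1 : s < 1) (hγ : 0 < γ)
    (h𝒯 : 𝒯.ShapeRegular γ) (hn : p + 1 ≤ n) (hu : u ∈ spline0 𝒯 p) (i j : Fin 𝒯.M) :
    ∫⁻ x in 𝒯.elem i, ∫⁻ y in 𝒯.elem j, ENNReal.ofReal (|u x - u y| ^ 2 / |x - y| ^ (1 + 2 * s))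
      ≤ ENNReal.ofReal ((1 + 2 / γ) ^ (1 + 2 * s) * Qelem 𝒯 s n u u i j) := by
  -- Both sides are symmetric in the two elements.
  wlog hij : i ≤ j generalizing i j
  · rw [lintegral_slobodeckij_comm hu.1.1, Qelem_comm]
    exact this j i (le_of_not_ge hij)
  obtain ⟨P, hdeg, hP, hv, -, -⟩ := exists_pieces hu
  have hg : 0 < 1 / γ := one_div_pos.2 hγ
  have hK : 1 + 2 / γ = 1 + 2 * (1 / γ) := by ring
  have hK1 : 1 ≤ 1 + 2 / γ := by rw [hK]; linarith
  have hK0 : 0 < 1 + 2 / γ := one_pos.trans_le hK1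
  have hi := 𝒯.h_pos i
  have hj := 𝒯.h_pos j
  rcases hij.eq_or_lt with rfl | hlt
  · refine (lintegral_ident_le hs1 hn hdeg hP i).trans (ENNReal.ofReal_le_ofReal ?_)
    rw [Qelem, if_pos rfl]
    exact le_mul_of_one_le_left (Qident_nonneg hs1 i) (Real.one_le_rpow hK1 (by positivity))
  rw [Qelem, if_neg hlt.ne]
  by_cases hadj : (i : ℕ) + 1 = j
  · rw [if_pos hadj]
    have e := 𝒯.right_eq_left hadj
    obtain ⟨h1, h2⟩ := h𝒯.h_le hγ e
    refine lintegral_adj_le hs0 hs1 hn hdeg hP e (hv i j hadj) hK0 ?_ ?_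
    · rw [hK]; nlinarith
    · rw [hK]; nlinarith
  · have hlt' : (i : ℕ) < j := hlt
    rw [if_neg hadj, if_neg (by omega), if_pos hlt]
    have hi1 : (i : ℕ) + 1 < 𝒯.M := by omega
    have hj1 : (j : ℕ) - 1 < 𝒯.M := by omega
    have e1 : 𝒯.right i = 𝒯.left ⟨i + 1, hi1⟩ := 𝒯.right_eq_left rfl
    have e2 : 𝒯.right ⟨j - 1, hj1⟩ = 𝒯.left j := 𝒯.right_eq_left (by simp only []; omega)
    have h1 := (h𝒯.h_le_of_lt hγ (i := i) (j := ⟨j - 1, hj1⟩)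
      (by rw [Fin.lt_def]; simp only []; omega)).1
    have h2 := (h𝒯.h_le_of_lt hγ (i := ⟨i + 1, hi1⟩) (j := j)
      (by rw [Fin.lt_def]; simp only []; omega)).2
    rw [e2] at h1
    rw [← e1] at h2
    -- Both lengths are at most `1 / γ` times the gap: this makes the gap positive and, added up,
    -- gives the constant `1 + 2 / γ`.
    have hd : 0 < 𝒯.left j - 𝒯.right i := by
      by_contra! hle
      nlinarith
    refine lintegral_sep_le hs0 hn hdeg hP hK0 hd ?_
    rw [hK]; linarith

theorem lintegral_slobodeckij_le {p : ℕ} (hs0 : 0 < s) (hs1 : s < 1) (hγ : 0 < γ)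
    (h𝒯 : 𝒯.ShapeRegular γ) (hn : p + 1 ≤ n) (hu : u ∈ spline0 𝒯 p) :
    ∫⁻ x in Ω, ∫⁻ y in Ω, ENNReal.ofReal (|u x - u y| ^ 2 / |x - y| ^ (1 + 2 * s))
      ≤ ENNReal.ofReal ((1 + 2 / γ) ^ (1 + 2 * s) * ∑ i, ∑ j, Qelem 𝒯 s n u u i j) := by
  have hK : 0 ≤ (1 + 2 / γ) ^ (1 + 2 * s) := by positivity
  calc _ ≤ ∑ i, ∫⁻ x in 𝒯.elem i, ∑ j, ∫⁻ y in 𝒯.elem j,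
          ENNReal.ofReal (|u x - u y| ^ 2 / |x - y| ^ (1 + 2 * s)) :=
        (𝒯.lintegral_Ω_le _).trans (Finset.sum_le_sum fun i _ =>
          lintegral_mono fun x => 𝒯.lintegral_Ω_le _)
    _ = ∑ i, ∑ j, ∫⁻ x in 𝒯.elem i, ∫⁻ y in 𝒯.elem j,
          ENNReal.ofReal (|u x - u y| ^ 2 / |x - y| ^ (1 + 2 * s)) :=
        Finset.sum_congr rfl fun i _ => lintegral_finsetSum' _ fun j _ =>
          (aemeasurable_slobodeckij hu.1.1 i j).lintegral_prod_right'
    _ ≤ ∑ i, ∑ j, ENNReal.ofReal ((1 + 2 / γ) ^ (1 + 2 * s) * Qelem 𝒯 s n u u i j) :=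
        Finset.sum_le_sum fun i _ => Finset.sum_le_sum fun j _ =>
          lintegral_elem_elem_le hs0 hs1 hγ h𝒯 hn hu i j
    _ = _ := by
        rw [Finset.mul_sum, ENNReal.ofReal_sum_of_nonneg fun i _ =>
          mul_nonneg hK (Finset.sum_nonneg fun j _ => Qelem_nonneg hs1 i j)]
        refine Finset.sum_congr rfl fun i _ => ?_
        rw [Finset.mul_sum, ENNReal.ofReal_sum_of_nonneg fun j _ =>
          mul_nonneg hK (Qelem_nonneg hs1 i j)]

theorem lintegral_weighted_elem_le {p : ℕ} (hs0 : 0 < s) (hs1 : s < 1) (hγ : 0 < γ)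
    (h𝒯 : 𝒯.ShapeRegular γ) (hn : p + 1 ≤ n) (hu : u ∈ spline0 𝒯 p) (i : Fin 𝒯.M) :
    ∫⁻ x in 𝒯.elem i, ENNReal.ofReal (|u x / bdist x ^ s| ^ 2)
      ≤ ENNReal.ofReal ((1 + 2 / γ) ^ (2 * s) * (2 * s) * Qcompl 𝒯 s n u u i) := by
  obtain ⟨P, hdeg, hP, -, hl, hr⟩ := exists_pieces hu
  have hi := 𝒯.h_pos i
  have hg : 0 < 1 / γ := one_div_pos.2 hγ
  have hK : 1 + 2 / γ = 1 + 2 * (1 / γ) := by ring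
  have hK1 : 1 ≤ 1 + 2 / γ := by rw [hK]; linarith
  have hM := i.2
  have bl := lintegral_left_le hs0 hs1 hn hdeg hP (hl i) hK1 (fun h0 => by
    have h1 := (h𝒯.h_le_of_lt hγ (i := ⟨0, by omega⟩) (j := i)
      (by rw [Fin.lt_def]; simp only []; omega)).2
    rw [𝒯.left_eq_neg_one (i := ⟨0, by omega⟩) rfl] at h1
    have hd : 0 < 𝒯.left i - (-1) := by
      by_contra! hle
      nlinarith
    refine ⟨hd, ?_⟩
    rw [hK]; nlinarith)
  have br := lintegral_right_le hs0 hs1 hn hdeg hP (hr i) hK1 (fun h0 => by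
    have h1 := (h𝒯.h_le_of_lt hγ (i := i) (j := ⟨𝒯.M - 1, by omega⟩)
      (by rw [Fin.lt_def]; simp only []; omega)).1
    rw [𝒯.right_eq_one (i := ⟨𝒯.M - 1, by omega⟩) (by simp only []; omega)] at h1
    have hd : 0 < 1 - 𝒯.right i := by
      by_contra! hle
      nlinarith
    refine ⟨hd, ?_⟩
    rw [hK]; nlinarith)
  have hmeas : AEMeasurable (fun x => ENNReal.ofReal (u x ^ 2 / |1 + x| ^ (2 * s)))
      (volume.restrict (𝒯.elem i)) := by
    have h3 : Measurable fun x : ℝ => |1 + x| ^ (2 * s) := by fun_prop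
    exact (((aemeasurable_elem hu.1.1 i).pow_const 2).div h3.aemeasurable).ennreal_ofReal
  -- The boundary distance is one of `1 + x` and `1 - x`, so its negative power is at most the sum
  -- of both.
  calc _ ≤ ∫⁻ x in 𝒯.elem i, (ENNReal.ofReal (u x ^ 2 / |1 + x| ^ (2 * s))
          + ENNReal.ofReal (u x ^ 2 / |1 - x| ^ (2 * s))) := by
        refine setLIntegral_mono' measurableSet_Ioo fun x hx => ?_
        have hx' := 𝒯.elem_subset i hx
        rw [sq_abs_div_bdist hx']
        rcases (bdist_eq_or hx').1 with e | e
        · rw [e, abs_of_pos (by linarith [hx'.1])]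
          exact le_self_add
        · rw [e, abs_of_pos (a := 1 - x) (by linarith [hx'.2])]
          exact le_add_self
    _ ≤ _ := by
        rw [lintegral_add_left' hmeas]
        refine (add_le_add bl br).trans (le_of_eq ?_)
        rw [← ENNReal.ofReal_add]
        · have e : ∀ B h L R : ℝ, B * (h * L) + B * (h * R)
              = B * (2 * s) * (h / (2 * s) * (L + R)) := fun B h L R => by
            field_simp
          exact congrArg ENNReal.ofReal (e _ _ _ _)
        · refine mul_nonneg (by positivity) (mul_nonneg hi.le ?_)
          split_ifs
          · exact gaussJacobi_zero_left_nonneg (by linarith) fun x _ =>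
              div_nonneg (mul_self_nonneg _) (by positivity)
          · exact gaussLegendre_nonneg fun x _ => div_nonneg (mul_self_nonneg _) (by positivity)
        · refine mul_nonneg (by positivity) (mul_nonneg hi.le ?_)
          split_ifs
          · exact gaussJacobi_zero_right_nonneg (by linarith) fun x _ =>
              div_nonneg (mul_self_nonneg _) (by positivity)
          · exact gaussLegendre_nonneg fun x _ => div_nonneg (mul_self_nonneg _) (by positivity)

theorem Qcompl_nonneg (hs0 : 0 < s) (hs1 : s < 1) (i : Fin 𝒯.M) : 0 ≤ Qcompl 𝒯 s n u u i := by
  have hi := 𝒯.h_pos i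
  unfold Qcompl
  refine mul_nonneg (by positivity) (add_nonneg ?_ ?_)
  · split_ifs
    · exact gaussJacobi_zero_left_nonneg (by linarith) fun x _ =>
        div_nonneg (mul_self_nonneg _) (by positivity)
    · exact gaussLegendre_nonneg fun x _ => div_nonneg (mul_self_nonneg _) (by positivity)
  · split_ifs
    · exact gaussJacobi_zero_right_nonneg (by linarith) fun x _ =>
        div_nonneg (mul_self_nonneg _) (by positivity)
    · exact gaussLegendre_nonneg fun x _ => div_nonneg (mul_self_nonneg _) (by positivity)

theorem lintegral_weighted_le {p : ℕ} (hs0 : 0 < s) (hs1 : s < 1) (hγ : 0 < γ)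
    (h𝒯 : 𝒯.ShapeRegular γ) (hn : p + 1 ≤ n) (hu : u ∈ spline0 𝒯 p) :
    ∫⁻ x in Ω, ENNReal.ofReal (|u x / bdist x ^ s| ^ 2)
      ≤ ENNReal.ofReal ((1 + 2 / γ) ^ (2 * s) * (2 * s) * ∑ i, Qcompl 𝒯 s n u u i) := by
  rw [Finset.mul_sum, ENNReal.ofReal_sum_of_nonneg fun i _ =>
    mul_nonneg (by positivity) (Qcompl_nonneg hs0 hs1 i)]
  exact (𝒯.lintegral_Ω_le _).trans (Finset.sum_le_sum fun i _ =>
    lintegral_weighted_elem_le hs0 hs1 hγ h𝒯 hn hu i)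

theorem lintegral_sq_le_weighted (hs0 : 0 < s) :
    ∫⁻ x in Ω, ENNReal.ofReal (|u x| ^ 2)
      ≤ ∫⁻ x in Ω, ENNReal.ofReal (|u x / bdist x ^ s| ^ 2) := by
  refine setLIntegral_mono' measurableSet_Ioo fun x hx => ENNReal.ofReal_le_ofReal ?_
  rw [sq_abs_div_bdist hx, sq_abs]
  have h1 := bdist_pos hx
  exact le_div_self (sq_nonneg _) (Real.rpow_pos_of_pos h1 _)
    (Real.rpow_le_one h1.le (bdist_eq_or hx).2 (by positivity))

theorem HtildeNormSq_le {p : ℕ} (hs0 : 0 < s) (hs1 : s < 1) (hγ : 0 < γ)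
    (h𝒯 : 𝒯.ShapeRegular γ) (hn : p + 1 ≤ n) (hu : u ∈ spline0 𝒯 p) :
    HtildeNormSq s u ≤ ENNReal.ofReal
      (4 * (1 + 2 / γ) ^ (1 + 2 * s) / fracConst s * aTilde 𝒯 s n u u) := by
  have hC := fracConst_pos hs0 hs1
  set S := ∑ i, ∑ j, Qelem 𝒯 s n u u i j with hS
  set V := ∑ i, Qcompl 𝒯 s n u u i with hV
  have hS0 : 0 ≤ S :=
    Finset.sum_nonneg fun i _ => Finset.sum_nonneg fun j _ => Qelem_nonneg hs1 i j
  have hV0 : 0 ≤ V := Finset.sum_nonneg fun i _ => Qcompl_nonneg hs0 hs1 i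
  have b1 := lintegral_slobodeckij_le hs0 hs1 hγ h𝒯 hn hu
  have b2 := lintegral_weighted_le hs0 hs1 hγ h𝒯 hn hu
  have b3 := (lintegral_sq_le_weighted (u := u) hs0).trans b2
  rw [← hS] at b1
  rw [← hV] at b2 b3
  rw [HtildeNormSq]
  refine (add_le_add (add_le_add b3 b1) b2).trans ?_
  rw [← ENNReal.ofReal_add (by positivity) (by positivity),
    ← ENNReal.ofReal_add (by positivity) (by positivity)]
  refine ENNReal.ofReal_le_ofReal ?_
  -- With `A` and `B` the powers of `1 + 2 / γ` with exponents `1 + 2s` and `2s`, the three parts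
  -- add up to at most `A * S + 2 * (B * 2s * V)`. As `B ≤ A` and `s < 1`, this is below `A * S + 4
  -- * A * V ≤ 2 * A * (S + 2 * V)`, whence the factor `4 / fracConst s`.
  have e : 4 * (1 + 2 / γ) ^ (1 + 2 * s) / fracConst s * aTilde 𝒯 s n u u
      = 2 * (1 + 2 / γ) ^ (1 + 2 * s) * (S + 2 * V) := by
    rw [aTilde, ← hS, ← hV]
    field_simp
    ring
  have hK1 : 1 ≤ 1 + 2 / γ := le_add_of_nonneg_right (by positivity)
  have hmono : (1 + 2 / γ) ^ (2 * s) ≤ (1 + 2 / γ) ^ (1 + 2 * s) :=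
    Real.rpow_le_rpow_of_exponent_le hK1 (by linarith)
  have hB : 0 ≤ (1 + 2 / γ) ^ (2 * s) := by positivity
  rw [e]
  generalize (1 + 2 / γ) ^ (1 + 2 * s) = A at *
  generalize (1 + 2 / γ) ^ (2 * s) = B at *
  have h1 : B * (2 * s) * V ≤ A * 2 * V := by
    refine mul_le_mul_of_nonneg_right ?_ hV0
    exact mul_le_mul hmono (by linarith) (by positivity) (hB.trans hmono)
  have h2 : 0 ≤ A * S := mul_nonneg (hB.trans hmono) hS0
  linarith

end FracQuad

theorem mainTheorem3 (s γ : ℝ) (hs0 : 0 < s) (hs1 : s < 1) (hγ : 0 < γ) :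
    ∃ c : ℝ, 0 < c ∧
      ∀ 𝒯 : FracQuad.Mesh, 𝒯.ShapeRegular γ →
        ∀ p n : ℕ, p + 1 ≤ n →
          ∀ u ∈ FracQuad.spline0 𝒯 p,
            FracQuad.HtildeNormSq s u < ⊤ ∧
              c * (FracQuad.HtildeNormSq s u).toReal ≤ FracQuad.aTilde 𝒯 s n u u := by
  have hC := FracQuad.fracConst_pos hs0 hs1
  have hK : 0 < 4 * (1 + 2 / γ) ^ (1 + 2 * s) / FracQuad.fracConst s := by positivity
  refine ⟨(4 * (1 + 2 / γ) ^ (1 + 2 * s) / FracQuad.fracConst s)⁻¹, inv_pos.2 hK,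
    fun 𝒯 h𝒯 p n hn u hu => ?_⟩
  have hle := FracQuad.HtildeNormSq_le hs0 hs1 hγ h𝒯 hn hu
  have hnonneg : 0 ≤ FracQuad.aTilde 𝒯 s n u u :=
    mul_nonneg (by positivity) (add_nonneg
      (Finset.sum_nonneg fun i _ => Finset.sum_nonneg fun j _ => FracQuad.Qelem_nonneg hs1 i j)
      (mul_nonneg zero_le_two (Finset.sum_nonneg fun i _ => FracQuad.Qcompl_nonneg hs0 hs1 i)))
  refine ⟨hle.trans_lt ENNReal.ofReal_lt_top, ?_⟩
  rw [inv_mul_le_iff₀ hK]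
  exact ENNReal.toReal_le_of_le_ofReal (mul_nonneg hK.le hnonneg) hle
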